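/- Let $n\ge 3$. Pseudo-Riemannian manifolds are smooth and may have any signature; $\nabla$ is the Levi-Civita connection, and the Riemann curvature tensor $\mathrm{Rm}=(R_{abcd})$ is defined by $\nabla_a\nabla_b\tau_c-\nabla_b\nabla_a\tau_c=R_{abc}{}^d\tau_d$, with $R_{ab}=R_{acb}{}^c$ the Ricci tensor. A tensor Riemannian invariant $I$ of rank $k$ is given by a fixed $\mathbb{R}$-linear combination of partial contractions (with respect to the inverse metric, with $k$ free indices) of tensors $\nabla^{N_1}\mathrm{Rm}\otimes\cdots\otimes\nabla^{N_j}\mathrm{Rm}\otimes g^{\otimes\ell}$; its evaluation at $(M,g)$ is the section $I^g$ of $\otimes^kT^*M$. The same combination, with the same real coefficients, is used to evaluate $I$ in every dimension. On $n$-manifolds, $I$ is symmetric if $I^g$ is a symmetric tensor for every pseudo-Riemannian $n$-manifold $(M^n,g)$, and it has weight $w\in\mathbb{R}$ if $I^{c^2g}=c^wI^g$ for every such $(M^n,g)$ and every constant $c>0$. An invariant $I$ of weight $w$ is straightenable if, for every Einstein manifold $(M^n,g)$ with $\mathrm{Ric}=2\lambda(n-1)g$, the evaluation $\widetilde I$ of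 $I$ at the ambient space $$\widetilde{\mathcal G}=(0,\infty)_t\times M\times(-\varepsilon,\varepsilon)_\rho,\qquad \widetilde g=2\rho\,dt^2+2t\,dt\,d\rho+\tau^2g,\qquad \tau=t(1+\lambda\rho),$$ satisfies $\widetilde I=\tau^w\pi^*I^g$, where $\pi\colon\widetilde{\mathcal G}\to M$ is the projection and $\varepsilon>0$ is such that $1+\lambda\rho>0$ for $|\rho|<\varepsilon$. **Proposition.** Let $k\ge1$, let $w\in\mathbb{R}$, with $w\neq 2k-2$ if $k\ge2$, and let $T_{a_1\cdots a_k}$ be a straightenable symmetric tensor Riemannian invariant of rank $k$ and weight $w$ on $n$-manifolds. Then $$U_{a_1\cdots a_{k-1}}:=\nabla^bT_{a_1\cdots a_{k-1}b}+\frac{k-1}{w-2k+2}\nabla_{(a_1}T_{a_2\cdots a_{k-1})b}{}^b$$ (where the second term is absent if $k=1$, and round parentheses denote symmetrization, normalized by $1/(k-1)!$) is a straightenable symmetric tensor Riemannian invariant of rank $k-1$ and weight $w-2$ on $n$-manifolds. More precisely, there is a tensor Riemannian invariant $U$ of rank $k-1$ whose evaluation at every pseudo-Riemannian manifold, of any dimension,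 is given by this formula, and $U$ is symmetric, of weight $w-2$ and straightenable on $n$-manifolds. -/

import Mathlib

open scoped Manifold ContDiff

noncomputable section

/-!
## Tensor calculus in local coordinates

`V` is the coordinate space, `b` a basis of it (the coordinate frame, indexed by `ι`).
The components of a covariant tensor field of rank `k` in these coordinates form a function
`V → (Fin k → ι) → ℝ`; the components of a metric form a function `V → Matrix ι ι ℝ`, and the
inverse metric is the inverse matrix.
-/

section Local

variable {ι V : Type} [Fintype ι] [DecidableEq ι] [NormedAddCommGroup V] [NormedSpace ℝ V]

/-- The partial derivative of `f` at `x` in the direction of the `i`-th coordinate. -/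
def partialDeriv (b : Module.Basis ι ℝ V) (i : ι) (f : V → ℝ) (x : V) : ℝ :=
  fderiv ℝ f x (b i)

/-- The Christoffel symbol `Γ^c_{ij}` of the Levi-Civita connection of the metric `G`. -/
def christoffel (b : Module.Basis ι ℝ V) (G : V → Matrix ι ι ℝ) (c i j : ι) (x : V) : ℝ :=
  (1 / 2) * ∑ l, (G x)⁻¹ c l *
    (partialDeriv b i (fun y => G y j l) x + partialDeriv b j (fun y => G y i l) x
      - partialDeriv b l (fun y => G y i j) x)

/-- The Levi-Civita covariant derivative of a covariant tensor field; the index of the derivative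
comes first: `covDeriv b G T x ![a₀, a₁, …, a_k] = ∇_{a₀} T_{a₁…a_k}`. -/
def covDeriv {k : ℕ} (b : Module.Basis ι ℝ V) (G : V → Matrix ι ι ℝ)
    (T : V → (Fin k → ι) → ℝ) : V → (Fin (k + 1) → ι) → ℝ := fun x a =>
  partialDeriv b (a 0) (fun y => T y (Fin.tail a)) x
    - ∑ s : Fin k, ∑ d : ι,
        christoffel b G d (a 0) (Fin.tail a s) x * T x (Function.update (Fin.tail a) s d)

/-- The curvature `R_{ijc}{}^d`, with the convention
`∇_i ∇_j τ_c - ∇_j ∇_i τ_c = R_{ijc}{}^d τ_d`. -/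
def curvatureUp (b : Module.Basis ι ℝ V) (G : V → Matrix ι ι ℝ) (i j c d : ι) (x : V) : ℝ :=
  partialDeriv b j (christoffel b G d i c) x - partialDeriv b i (christoffel b G d j c) x
    + ∑ e, (christoffel b G e i c x * christoffel b G d j e x
        - christoffel b G e j c x * christoffel b G d i e x)

/-- The Riemann curvature tensor `R_{abcd} = R_{abc}{}^e g_{ed}`. -/
def riemannTensor (b : Module.Basis ι ℝ V) (G : V → Matrix ι ι ℝ) : V → (Fin 4 → ι) → ℝ :=
  fun x a => ∑ e, curvatureUp b G (a 0) (a 1) (a 2) e x * G x e (a 3)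

/-- The Ricci tensor `R_{ij} = R_{icj}{}^c`. -/
def ricciTensor (b : Module.Basis ι ℝ V) (G : V → Matrix ι ι ℝ) (i j : ι) (x : V) : ℝ :=
  ∑ c, curvatureUp b G i c j c x

/-- The iterated covariant derivative `∇^N Rm`, a tensor of rank `4 + N`. -/
def nablaRiemann (b : Module.Basis ι ℝ V) (G : V → Matrix ι ι ℝ) :
    (N : ℕ) → V → (Fin (4 + N) → ι) → ℝ
  | 0 => riemannTensor b G
  | N + 1 => covDeriv b G (nablaRiemann b G N)

/-- The divergence `∇^c T_{a₁…a_r c}`. -/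
def divergence {r : ℕ} (b : Module.Basis ι ℝ V) (G : V → Matrix ι ι ℝ)
    (T : V → (Fin (r + 1) → ι) → ℝ) : V → (Fin r → ι) → ℝ := fun x a =>
  ∑ i, ∑ j, (G x)⁻¹ i j *
    covDeriv b G T x (Fin.cons i (Fin.snoc a j : Fin (r + 1) → ι) : Fin (r + 2) → ι)

/-- The trace `T_{a₁…a_q c}{}^c` over the last two indices. -/
def traceLast {q : ℕ} (G : V → Matrix ι ι ℝ)
    (T : V → (Fin (q + 2) → ι) → ℝ) : V → (Fin q → ι) → ℝ := fun x a =>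
  ∑ i, ∑ j, (G x)⁻¹ i j *
    T x (Fin.snoc (Fin.snoc a i : Fin (q + 1) → ι) j : Fin (q + 2) → ι)

/-- The symmetrization `T_{(a₁…a_k)}`. -/
def symmetrize {k : ℕ} (T : V → (Fin k → ι) → ℝ) : V → (Fin k → ι) → ℝ := fun x a =>
  (1 / (k.factorial : ℝ)) * ∑ σ : Equiv.Perm (Fin k), T x (a ∘ σ)

/-- For a tensor field `T` of rank `k = r + 1`, the tensor field of rank `k - 1 = r`
`∇^c T_{a₁…a_{k-1}c} + (k-1)/(w-2k+2) ∇_{(a₁} T_{a₂…a_{k-1})c}{}^c`.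
The second term is absent if `k = 1`. -/
def modifiedDivergence (b : Module.Basis ι ℝ V) (G : V → Matrix ι ι ℝ) (w : ℝ) :
    (r : ℕ) → (V → (Fin (r + 1) → ι) → ℝ) → V → (Fin r → ι) → ℝ
  | 0, T => divergence b G T
  | q + 1, T =>
      let k : ℝ := (q + 2 : ℕ)
      fun x a => divergence b G T x a
        + (k - 1) / (w - 2 * k + 2) * symmetrize (covDeriv b G (traceLast G T)) x a

/-!
## Riemannian invariants
-/

/-- A partial contraction, with `k` free indices, of
`∇^{N₁}Rm ⊗ ⋯ ⊗ ∇^{N_j}Rm ⊗ g^{⊗ℓ}`, where `j = numCurv`, `N_i = order i` and `ℓ = numMetric`.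
Every index slot of the tensor product is either one of the `k` free indices (in any order)
or one of the two members of one of `numPairs` contracted pairs. -/
structure PartialContraction (k : ℕ) where
  numCurv : ℕ
  order : Fin numCurv → ℕ
  numMetric : ℕ
  numPairs : ℕ
  slots : ((Σ i : Fin numCurv, Fin (4 + order i)) ⊕ (Fin numMetric × Fin 2)) ≃
    (Fin k ⊕ (Fin numPairs × Fin 2))

/-- The value of a partial contraction: `a` holds the free indices, the sum runs over all
values `c` of the contracted indices, and all contractions are made with the inverse metric. -/
def PartialContraction.eval {k : ℕ} (m : PartialContraction k) (b : Module.Basis ι ℝ V)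
    (G : V → Matrix ι ι ℝ) : V → (Fin k → ι) → ℝ := fun x a =>
  ∑ c : Fin m.numPairs × Fin 2 → ι,
    (∏ p, (G x)⁻¹ (c (p, 0)) (c (p, 1)))
      * (∏ i, nablaRiemann b G (m.order i) x
          fun s => Sum.elim a c (m.slots (Sum.inl ⟨i, s⟩)))
      * ∏ l, G x (Sum.elim a c (m.slots (Sum.inr (l, 0))))
          (Sum.elim a c (m.slots (Sum.inr (l, 1))))

/-- A tensor Riemannian invariant of rank `k`: a real linear combination of partial contractions.
The same combination, with the same real coefficients, can be evaluated at metrics in every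
dimension. -/
def RiemannianInvariant (k : ℕ) : Type := PartialContraction k →₀ ℝ

/-- The components of a Riemannian invariant at a metric with components `G`. -/
def RiemannianInvariant.eval {k : ℕ} (I : RiemannianInvariant k) (b : Module.Basis ι ℝ V)
    (G : V → Matrix ι ι ℝ) : V → (Fin k → ι) → ℝ := fun x a =>
  Finsupp.sum I fun m r => r * m.eval b G x a

end Local

/-!
## Pseudo-Riemannian manifolds
-/

/-- The components `g(∂_i, ∂_j)` of a field `g` of bilinear forms on the tangent spaces of a
manifold in the coordinates given by the chart `e`, as functions of the coordinates. -/
def metricComponents {ι V H M : Type} [NormedAddCommGroup V] [NormedSpace ℝ V]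
    [TopologicalSpace H] (I : ModelWithCorners ℝ V H) [TopologicalSpace M] [ChartedSpace H M]
    (b : Module.Basis ι ℝ V) (g : ∀ p : M, TangentSpace I p →L[ℝ] TangentSpace I p →L[ℝ] ℝ)
    (e : OpenPartialHomeomorph M H) (x : V) : Matrix ι ι ℝ :=
  Matrix.of fun i j =>
    g ((e.extend I).symm x)
      (mfderiv 𝓘(ℝ, V) I (e.extend I).symm x (b i))
      (mfderiv 𝓘(ℝ, V) I (e.extend I).symm x (b j))

/-- The standard coordinate frame of `ℝⁿ`. -/
def stdFrame (n : ℕ) : Module.Basis (Fin n) ℝ (EuclideanSpace ℝ (Fin n)) :=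
  (EuclideanSpace.basisFun (Fin n) ℝ).toBasis

/-- A smooth (Hausdorff, second countable) `n`-manifold with a smooth pseudo-Riemannian metric
of any signature. -/
structure PseudoRiemannianManifold (n : ℕ) where
  carrier : Type
  [topology : TopologicalSpace carrier]
  [t2 : T2Space carrier]
  [secondCountable : SecondCountableTopology carrier]
  [charted : ChartedSpace (EuclideanSpace ℝ (Fin n)) carrier]
  [manifold : IsManifold (𝓡 n) ∞ carrier]
  metric : ∀ p : carrier, TangentSpace (𝓡 n) p →L[ℝ] TangentSpace (𝓡 n) p →L[ℝ] ℝ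
  symmetric : ∀ p v u, metric p v u = metric p u v
  nondegenerate : ∀ p v, (∀ u, metric p v u = 0) → v = 0
  smooth : ∀ e ∈ IsManifold.maximalAtlas (𝓡 n) ∞ carrier, ∀ i j,
    ContDiffOn ℝ ∞ (fun x => metricComponents (𝓡 n) (stdFrame n) metric e x i j) e.target

namespace PseudoRiemannianManifold

attribute [instance] topology t2 secondCountable charted manifold

variable {n : ℕ}

/-- The coordinate charts of the smooth manifold `X`, with values in `ℝⁿ`. -/
abbrev Chart (X : PseudoRiemannianManifold n) : Type :=
  {e : OpenPartialHomeomorph X.carrier (EuclideanSpace ℝ (Fin n)) //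
    e ∈ IsManifold.maximalAtlas (𝓡 n) ∞ X.carrier}

/-- The metric `g_{ij}` of `X` in the chart `e`. -/
def gram (X : PseudoRiemannianManifold n) (e : X.Chart) :
    EuclideanSpace ℝ (Fin n) → Matrix (Fin n) (Fin n) ℝ :=
  metricComponents (𝓡 n) (stdFrame n) X.metric e.1

/-- The Einstein condition `Ric = 2λ(n-1) g`. -/
def IsEinstein (X : PseudoRiemannianManifold n) (lam : ℝ) : Prop :=
  ∀ e : X.Chart, ∀ x ∈ e.1.target, ∀ i j,
    ricciTensor (stdFrame n) (X.gram e) i j x = 2 * lam * (n - 1) * X.gram e x i j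

/-!
### The straight and normal ambient space of an Einstein manifold

The ambient space `(0,∞)_t × M × (-ε,ε)_ρ` is an open subset of the product manifold `ℝ × M × ℝ`,
whose tangent space at `(t, p, ρ)` is `ℝ × T_pM × ℝ`.
-/

/-- The model of the product manifold `ℝ × M × ℝ`. -/
abbrev ambientModel (n : ℕ) : ModelWithCorners ℝ (ℝ × EuclideanSpace ℝ (Fin n) × ℝ)
    (ModelProd ℝ (ModelProd (EuclideanSpace ℝ (Fin n)) ℝ)) :=
  𝓘(ℝ, ℝ).prod ((𝓡 n).prod 𝓘(ℝ, ℝ))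

/-- The ambient metric `2ρ dt² + 2t dt dρ + τ² g`, `τ = t(1 + λρ)`. -/
def ambientMetric (X : PseudoRiemannianManifold n) (lam : ℝ) (q : ℝ × X.carrier × ℝ) :
    TangentSpace (ambientModel n) q →L[ℝ] TangentSpace (ambientModel n) q →L[ℝ] ℝ :=
  let t : ℝ := q.1
  let rho : ℝ := q.2.2
  let dt : ℝ × EuclideanSpace ℝ (Fin n) × ℝ →L[ℝ] ℝ := ContinuousLinearMap.fst ℝ _ _
  let dpi : ℝ × EuclideanSpace ℝ (Fin n) × ℝ →L[ℝ] EuclideanSpace ℝ (Fin n) :=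
    (ContinuousLinearMap.fst ℝ _ _).comp (ContinuousLinearMap.snd ℝ _ _)
  let drho : ℝ × EuclideanSpace ℝ (Fin n) × ℝ →L[ℝ] ℝ :=
    (ContinuousLinearMap.snd ℝ _ _).comp (ContinuousLinearMap.snd ℝ _ _)
  let gM : EuclideanSpace ℝ (Fin n) →L[ℝ] EuclideanSpace ℝ (Fin n) →L[ℝ] ℝ := X.metric q.2.1
  (2 * rho) • dt.smulRight dt + t • (dt.smulRight drho + drho.smulRight dt)
    + (t * (1 + lam * rho)) ^ 2 • gM.bilinearComp dpi dpi

/-- The coordinates `(t, x, ρ)` on `ℝ × M × ℝ` given by a chart `x` of `M`. -/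
def ambientChart (X : PseudoRiemannianManifold n) (e : X.Chart) :
    OpenPartialHomeomorph (ℝ × X.carrier × ℝ)
      (ModelProd ℝ (ModelProd (EuclideanSpace ℝ (Fin n)) ℝ)) :=
  (OpenPartialHomeomorph.refl ℝ).prod (e.1.prod (OpenPartialHomeomorph.refl ℝ))

/-- The index set `{0, a, ∞}` of the coordinates `(t, x^a, ρ)`. -/
abbrev AmbientIndex (n : ℕ) : Type := Unit ⊕ (Fin n ⊕ Unit)

/-- The coordinate frame of the coordinates `(t, x, ρ)`. -/
def ambientFrame (n : ℕ) :
    Module.Basis (AmbientIndex n) ℝ (ℝ × EuclideanSpace ℝ (Fin n) × ℝ) :=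
  (Module.Basis.singleton Unit ℝ).prod ((stdFrame n).prod (Module.Basis.singleton Unit ℝ))

/-- The ambient metric in the coordinates `(t, x, ρ)`. -/
def ambientGram (X : PseudoRiemannianManifold n) (lam : ℝ) (e : X.Chart) :
    ℝ × EuclideanSpace ℝ (Fin n) × ℝ → Matrix (AmbientIndex n) (AmbientIndex n) ℝ :=
  metricComponents (ambientModel n) (ambientFrame n) (X.ambientMetric lam) (X.ambientChart e)

/-- The components of the pullback `π^* S` along `π(t, x, ρ) = x`, at a point, in terms of the
components of `S`. -/
def pullbackComponents {k : ℕ} (S : (Fin k → Fin n) → ℝ) (A : Fin k → AmbientIndex n) : ℝ :=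
  ∑ a : Fin k → Fin n, if A = (fun s => Sum.inr (Sum.inl (a s))) then S a else 0

end PseudoRiemannianManifold

/-!
## Properties of Riemannian invariants on `n`-manifolds

A section of `⊗^k T^*M` is described by its components in all charts of `M`; those of `I^g` in the
chart `e` are `I.eval (stdFrame n) (X.gram e)`.
-/

namespace RiemannianInvariant

variable {k : ℕ}

/-- `I^g` is a symmetric tensor for every pseudo-Riemannian `n`-manifold. -/
def IsSymmetric (n : ℕ) (I : RiemannianInvariant k) : Prop :=
  ∀ (X : PseudoRiemannianManifold n) (e : X.Chart), ∀ x ∈ e.1.target,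
    ∀ (σ : Equiv.Perm (Fin k)) (a : Fin k → Fin n),
      I.eval (stdFrame n) (X.gram e) x (a ∘ σ) = I.eval (stdFrame n) (X.gram e) x a

/-- `I` has weight `w`: `I^{c²g} = c^w I^g` for every pseudo-Riemannian `n`-manifold and every
constant `c > 0`. -/
def HasWeight (n : ℕ) (w : ℝ) (I : RiemannianInvariant k) : Prop :=
  ∀ (X : PseudoRiemannianManifold n) (c : ℝ), 0 < c → ∀ e : X.Chart, ∀ x ∈ e.1.target,
    ∀ a : Fin k → Fin n,
      I.eval (stdFrame n)
          (metricComponents (𝓡 n) (stdFrame n) (fun p => c ^ 2 • X.metric p) e.1) x a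
        = c ^ w * I.eval (stdFrame n) (X.gram e) x a

/-- `I`, of weight `w`, is straightenable: for every Einstein manifold `(M^n, g)` with
`Ric = 2λ(n-1) g`, the evaluation of `I` at the straight and normal ambient space
`(0,∞)_t × M × (-ε,ε)_ρ` equals `τ^w π^* I^g`, where `τ = t(1 + λρ)`. Here `ε` is so small
that `1 + λρ > 0` for `|ρ| < ε`. -/
def IsStraightenable (n : ℕ) (w : ℝ) (I : RiemannianInvariant k) : Prop :=
  I.HasWeight n w ∧
  ∀ (X : PseudoRiemannianManifold n) (lam : ℝ), X.IsEinstein lam →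
    ∀ ε : ℝ, 0 < ε → (∀ rho ∈ Set.Ioo (-ε) ε, 0 < 1 + lam * rho) →
    ∀ e : X.Chart, ∀ t ∈ Set.Ioi (0 : ℝ), ∀ x ∈ e.1.target, ∀ rho ∈ Set.Ioo (-ε) ε,
    ∀ A : Fin k → PseudoRiemannianManifold.AmbientIndex n,
      I.eval (PseudoRiemannianManifold.ambientFrame n) (X.ambientGram lam e) (t, x, rho) A
        = (t * (1 + lam * rho)) ^ w *
          PseudoRiemannianManifold.pullbackComponents
            (I.eval (stdFrame n) (X.gram e) x) A

end RiemannianInvariant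

end

/-! There are two independent points: that the formula for U is a Riemannian invariant, and that it
is compatible with the passage to the ambient space.

The first is the closure of partial contractions under the operations in the formula. Since g and
its inverse are parallel, the Leibniz rule turns the covariant derivative of a partial contraction
into the sum over its curvature factors of the same contraction with that factor differentiated once
more (`IndexContraction.covDeriv_eval`). Contractions and permutations of free slots only rewire
slots. None of this depends on the dimension, so `IsInvariantRule.modifiedDivergence` yields one U
with the same coefficients in every dimension. Symmetry is inherited from T. The weight drops by 2
because a constant rescaling fixes the connection, while each term of U involves one more inverse
metric than T.

For the second point, the ambient Christoffel symbols with upper index k on the base are those of g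
plus τ_B/τ δ^k_C + τ_C/τ δ^k_B, where τ_B are the components of dτ (`christoffel_ambientMatrix`). A
lift τ^w π^*S, with S of rank p, vanishes as soon as one index is not on the base, so only these
symbols matter, and (`covDeriv_homogeneousLift`) its ambient derivative is τ^w times π^*∇S + (w - p)
dτ/τ ⊗ π^*S - (the terms exchanging the index of dτ with one of S).

Put φ = dτ/τ ⊗ π^*(tr T), with T symmetric of rank k. The divergence of τ^w π^*T is τ^{w-2} times
the pulled back divergence minus (k-1) Sym φ. The trace of the lift is τ^{w-2} π^*(tr T), of rank
k-2, and its symmetrized derivative has the error term ((w-2) - (k-2) - (k-2)) Sym φ = (w-2k+2) Sym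
φ. The coefficient (k-1)/(w-2k+2) is exactly the one for which the two errors cancel
(`modifiedDivergence_homogeneousLift`). The Einstein equation enters through the straightenability
of T, which says that its ambient evaluation is such a lift. -/

set_option linter.unusedSectionVars false

/-! ### Smoothness of the tensor fields built from a metric. -/

section Smoothness

variable {ι V : Type} [Fintype ι] [DecidableEq ι] [NormedAddCommGroup V] [NormedSpace ℝ V]

/-- `G` is a smooth field of nondegenerate symmetric matrices on the open set `Ω`. -/
structure IsMetricOn (Ω : Set V) (G : V → Matrix ι ι ℝ) : Prop where
  isOpen : IsOpen Ω
  contDiffOn : ∀ i j, ContDiffOn ℝ ∞ (fun x => G x i j) Ω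
  symm : ∀ x ∈ Ω, ∀ i j, G x i j = G x j i
  isUnit_det : ∀ x ∈ Ω, IsUnit (G x).det

/-- The components of `T` are smooth on `Ω`. -/
def IsSmoothOn {S : Type} (Ω : Set V) (T : V → (S → ι) → ℝ) : Prop :=
  ∀ a, ContDiffOn ℝ ∞ (fun x => T x a) Ω

theorem contDiffOn_partialDeriv {Ω : Set V} (hΩ : IsOpen Ω) (b : Module.Basis ι ℝ V) (i : ι)
    {f : V → ℝ} (hf : ContDiffOn ℝ ∞ f Ω) : ContDiffOn ℝ ∞ (partialDeriv b i f) Ω :=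
  (hf.fderiv_of_isOpen hΩ (m := ∞) (by simp)).clm_apply contDiffOn_const

theorem contDiffOn_det {Ω : Set V} {G : V → Matrix ι ι ℝ}
    (hG : ∀ i j, ContDiffOn ℝ ∞ (fun x => G x i j) Ω) :
    ContDiffOn ℝ ∞ (fun x => (G x).det) Ω := by
  simp only [Matrix.det_apply']
  exact ContDiffOn.sum fun σ _ =>
    contDiffOn_const.mul (contDiffOn_prod fun i _ => hG _ _)

namespace IsMetricOn

variable {Ω : Set V} {G : V → Matrix ι ι ℝ}

/-- Cramer's rule: the entries of the adjugate are themselves determinants of matrices with smooth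
entries. -/
theorem contDiffOn_inv (hG : IsMetricOn Ω G) (i j : ι) :
    ContDiffOn ℝ ∞ (fun x => (G x)⁻¹ i j) Ω := by
  have hadj : ContDiffOn ℝ ∞ (fun x => (G x).adjugate i j) Ω := by
    simp only [Matrix.adjugate_apply]
    refine contDiffOn_det fun k l => ?_
    simp only [Matrix.updateRow_apply]
    split_ifs
    · exact contDiffOn_const
    · exact hG.contDiffOn k l
  simp only [Matrix.inv_def, Ring.inverse_eq_inv', Matrix.smul_apply, smul_eq_mul]
  exact ((contDiffOn_det hG.contDiffOn).inv fun x hx => (hG.isUnit_det x hx).ne_zero).mul hadj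

theorem contDiffOn_christoffel (hG : IsMetricOn Ω G) (b : Module.Basis ι ℝ V) (c i j : ι) :
    ContDiffOn ℝ ∞ (christoffel b G c i j) Ω := by
  refine contDiffOn_const.mul (ContDiffOn.sum fun l _ => (hG.contDiffOn_inv c l).mul ?_)
  have h := fun i j k => contDiffOn_partialDeriv hG.isOpen b i (hG.contDiffOn j k)
  exact ((h i j l).add (h j i l)).sub (h l i j)

theorem isSmoothOn_covDeriv (hG : IsMetricOn Ω G) (b : Module.Basis ι ℝ V) {k : ℕ}
    {T : V → (Fin k → ι) → ℝ} (hT : IsSmoothOn Ω T) : IsSmoothOn Ω (covDeriv b G T) := fun _ =>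
  (contDiffOn_partialDeriv hG.isOpen b _ (hT _)).sub <| ContDiffOn.sum fun _ _ =>
    ContDiffOn.sum fun _ _ => (hG.contDiffOn_christoffel b _ _ _).mul (hT _)

theorem isSmoothOn_nablaRiemann (hG : IsMetricOn Ω G) (b : Module.Basis ι ℝ V) :
    ∀ N, IsSmoothOn Ω (nablaRiemann b G N)
  | 0 => fun a => by
      have hΓ := hG.contDiffOn_christoffel b
      refine ContDiffOn.sum fun e _ => ContDiffOn.mul ?_ (hG.contDiffOn _ _)
      exact ((contDiffOn_partialDeriv hG.isOpen b _ (hΓ _ _ _)).sub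
        (contDiffOn_partialDeriv hG.isOpen b _ (hΓ _ _ _))).add <|
        ContDiffOn.sum fun _ _ => ((hΓ _ _ _).mul (hΓ _ _ _)).sub ((hΓ _ _ _).mul (hΓ _ _ _))
  | N + 1 => hG.isSmoothOn_covDeriv b (hG.isSmoothOn_nablaRiemann b N)

theorem isSmoothOn_partialContraction (hG : IsMetricOn Ω G) (b : Module.Basis ι ℝ V) {k : ℕ}
    (m : PartialContraction k) : IsSmoothOn Ω (m.eval b G) := fun _ =>
  ContDiffOn.sum fun _ _ => ((contDiffOn_prod fun _ _ => hG.contDiffOn_inv _ _).mul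
    (contDiffOn_prod fun _ _ => hG.isSmoothOn_nablaRiemann b _ _)).mul
    (contDiffOn_prod fun _ _ => hG.contDiffOn _ _)

theorem isSmoothOn_eval (hG : IsMetricOn Ω G) (b : Module.Basis ι ℝ V) {k : ℕ}
    (I : RiemannianInvariant k) : IsSmoothOn Ω (I.eval b G) := fun a =>
  ContDiffOn.sum fun m _ => contDiffOn_const.mul (hG.isSmoothOn_partialContraction b m a)

theorem isSmoothOn_traceLast (hG : IsMetricOn Ω G) {q : ℕ}
    {T : V → (Fin (q + 2) → ι) → ℝ} (hT : IsSmoothOn Ω T) : IsSmoothOn Ω (traceLast G T) :=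
  fun _ => ContDiffOn.sum fun _ _ => ContDiffOn.sum fun _ _ => (hG.contDiffOn_inv _ _).mul (hT _)

end IsMetricOn

theorem IsSmoothOn.differentiableAt {S : Type} {Ω : Set V} {T : V → (S → ι) → ℝ}
    (hT : IsSmoothOn Ω T) (hΩ : IsOpen Ω) {x : V} (hx : x ∈ Ω) (a : S → ι) :
    DifferentiableAt ℝ (fun y => T y a) x :=
  ((hT a).contDiffAt (hΩ.mem_nhds hx)).differentiableAt (by simp)

end Smoothness

theorem fderiv_sum_mul_apply {V K : Type} [NormedAddCommGroup V] [NormedSpace ℝ V] [Fintype K]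
    {f g : K → V → ℝ} {x : V} (hf : ∀ k, DifferentiableAt ℝ (f k) x)
    (hg : ∀ k, DifferentiableAt ℝ (g k) x) (v : V) :
    fderiv ℝ (fun y => ∑ k, f k y * g k y) x v =
      ∑ k, (f k x * fderiv ℝ (g k) x v + g k x * fderiv ℝ (f k) x v) := by
  rw [fderiv_fun_sum fun k _ => DifferentiableAt.fun_mul (hf k) (hg k)]
  simp [fderiv_fun_mul (hf _) (hg _)]

/-! ### The metric and its inverse are parallel. -/

section MetricCompatibility

variable {ι V : Type} [Fintype ι] [DecidableEq ι] [NormedAddCommGroup V] [NormedSpace ℝ V]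
  {Ω : Set V} {G : V → Matrix ι ι ℝ}

namespace IsMetricOn

theorem sum_mul_inv (hG : IsMetricOn Ω G) {x : V} (hx : x ∈ Ω) (i j : ι) :
    ∑ k, G x i k * (G x)⁻¹ k j = if i = j then 1 else 0 := by
  rw [← Matrix.mul_apply, Matrix.mul_nonsing_inv _ (hG.isUnit_det x hx), Matrix.one_apply]

theorem sum_inv_mul (hG : IsMetricOn Ω G) {x : V} (hx : x ∈ Ω) (i j : ι) :
    ∑ k, (G x)⁻¹ i k * G x k j = if i = j then 1 else 0 := by
  rw [← Matrix.mul_apply, Matrix.nonsing_inv_mul _ (hG.isUnit_det x hx), Matrix.one_apply]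

theorem differentiableAt (hG : IsMetricOn Ω G) {x : V} (hx : x ∈ Ω) (i j : ι) :
    DifferentiableAt ℝ (fun y => G y i j) x :=
  ((hG.contDiffOn i j).contDiffAt (hG.isOpen.mem_nhds hx)).differentiableAt (by simp)

theorem differentiableAt_inv (hG : IsMetricOn Ω G) {x : V} (hx : x ∈ Ω) (i j : ι) :
    DifferentiableAt ℝ (fun y => (G y)⁻¹ i j) x :=
  ((hG.contDiffOn_inv i j).contDiffAt (hG.isOpen.mem_nhds hx)).differentiableAt (by simp)

/-- The Christoffel symbols of the first kind. -/
theorem sum_christoffel_mul (hG : IsMetricOn Ω G) (b : Module.Basis ι ℝ V) {x : V} (hx : x ∈ Ω)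
    (i j l : ι) : ∑ d, christoffel b G d i j x * G x d l =
      (1 / 2) * (partialDeriv b i (fun y => G y j l) x + partialDeriv b j (fun y => G y i l) x
        - partialDeriv b l (fun y => G y i j) x) := by
  simp only [christoffel, mul_assoc, ← Finset.mul_sum, Finset.sum_mul]
  rw [Finset.sum_comm]
  congr 1
  calc _ = ∑ m, (∑ d, G x l d * (G x)⁻¹ d m) *
        (partialDeriv b i (fun y => G y j m) x + partialDeriv b j (fun y => G y i m) x
        - partialDeriv b m (fun y => G y i j) x) := by
        refine Finset.sum_congr rfl fun m _ => ?_
        rw [Finset.sum_mul]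
        refine Finset.sum_congr rfl fun d _ => ?_
        rw [hG.symm x hx d l]
        ring
    _ = _ := by simp [hG.sum_mul_inv hx]

theorem partialDeriv_symm (hG : IsMetricOn Ω G) (b : Module.Basis ι ℝ V) {x : V} (hx : x ∈ Ω)
    (i j l : ι) :
    partialDeriv b i (fun y => G y j l) x = partialDeriv b i (fun y => G y l j) x := by
  have h : (fun y => G y j l) =ᶠ[nhds x] fun y => G y l j := by
    filter_upwards [hG.isOpen.mem_nhds hx] with y hy using hG.symm y hy j l
  rw [partialDeriv, partialDeriv, h.fderiv_eq]

/-- The metric is parallel. -/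
theorem partialDeriv_eq (hG : IsMetricOn Ω G) (b : Module.Basis ι ℝ V) {x : V} (hx : x ∈ Ω)
    (i j l : ι) : partialDeriv b i (fun y => G y j l) x =
      ∑ d, christoffel b G d i j x * G x d l + ∑ d, christoffel b G d i l x * G x j d := by
  simp only [hG.symm x hx j]
  rw [hG.sum_christoffel_mul b hx, hG.sum_christoffel_mul b hx, hG.partialDeriv_symm b hx i l j]
  ring

/-- The inverse metric is parallel. -/
theorem partialDeriv_inv_eq (hG : IsMetricOn Ω G) (b : Module.Basis ι ℝ V) {x : V} (hx : x ∈ Ω)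
    (i j l : ι) : partialDeriv b i (fun y => (G y)⁻¹ j l) x =
      -(∑ d, christoffel b G j i d x * (G x)⁻¹ d l + ∑ d, christoffel b G l i d x * (G x)⁻¹ j d) := by
  -- Differentiate g⁻¹g = 1; multiplying by g⁻¹ on the right then isolates the derivative of g⁻¹.
  have key : ∀ m, ∑ k, partialDeriv b i (fun y => (G y)⁻¹ j k) x * G x k m =
      -∑ k, (G x)⁻¹ j k * partialDeriv b i (fun y => G y k m) x := by
    intro m
    have h : (fun y => ∑ k, (G y)⁻¹ j k * G y k m) =ᶠ[nhds x]
        fun _ => if j = m then (1 : ℝ) else 0 := by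
      filter_upwards [hG.isOpen.mem_nhds hx] with y hy using hG.sum_inv_mul hy j m
    have h2 := congrArg (fun f : V →L[ℝ] ℝ => f (b i)) h.fderiv_eq
    simp only [fderiv_sum_mul_apply (hG.differentiableAt_inv hx j) fun k =>
      hG.differentiableAt hx k m, fderiv_fun_const, Pi.zero_apply, _root_.zero_apply,
      Finset.sum_add_distrib] at h2
    simp only [partialDeriv]
    rw [eq_neg_iff_add_eq_zero, add_comm, ← h2]
    simp only [mul_comm]
  have h1 : partialDeriv b i (fun y => (G y)⁻¹ j l) x =
      ∑ m, (∑ k, partialDeriv b i (fun y => (G y)⁻¹ j k) x * G x k m) * (G x)⁻¹ m l := by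
    simp only [Finset.sum_mul]
    rw [Finset.sum_comm]
    simp only [mul_assoc, ← Finset.mul_sum, hG.sum_mul_inv hx]
    simp
  rw [h1]
  simp only [key, hG.partialDeriv_eq b hx, neg_mul, Finset.sum_neg_distrib, mul_add,
    Finset.sum_add_distrib, add_mul]
  rw [neg_inj, add_comm]
  congr 1
  · refine Finset.sum_congr rfl fun m _ => ?_
    congr 1
    simp only [Finset.mul_sum]
    rw [Finset.sum_comm]
    calc _ = ∑ d, christoffel b G d i m x * ∑ k, (G x)⁻¹ j k * G x k d := by
          simp only [Finset.mul_sum]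
          exact Finset.sum_congr rfl fun d _ => Finset.sum_congr rfl fun k _ => by ring
      _ = _ := by simp [hG.sum_inv_mul hx]
  · simp only [Finset.mul_sum, Finset.sum_mul]
    rw [Finset.sum_comm]
    refine Finset.sum_congr rfl fun k _ => ?_
    rw [Finset.sum_comm]
    calc _ = ∑ d, (G x)⁻¹ j k * christoffel b G d i k x * ∑ m, G x d m * (G x)⁻¹ m l := by
          simp only [Finset.mul_sum]
          exact Finset.sum_congr rfl fun d _ => Finset.sum_congr rfl fun k _ => by ring
      _ = _ := by simp [hG.sum_mul_inv hx, mul_comm]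

end IsMetricOn

end MetricCompatibility

/-! ### Leibniz rules for covariant differentiation in a fixed direction, with arbitrary index
slots. -/

section TensorDerivative

variable {ι V : Type} [Fintype ι] [DecidableEq ι] [NormedAddCommGroup V] [NormedSpace ℝ V]

/-- The derivative in the direction `v` of a covariant tensor field with index slots `S`, with
respect to the connection whose matrix in the direction `v` is `A`. -/
noncomputable def tensorDeriv {S : Type} [Fintype S] [DecidableEq S] (A : ι → ι → ℝ) (v : V)
    (T : V → (S → ι) → ℝ) (x : V) (a : S → ι) : ℝ :=
  fderiv ℝ (fun y => T y a) x v - ∑ s, ∑ d, A d (a s) * T x (Function.update a s d)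

theorem covDeriv_eq_tensorDeriv {k : ℕ} (b : Module.Basis ι ℝ V) (G : V → Matrix ι ι ℝ)
    (T : V → (Fin k → ι) → ℝ) (x : V) (a : Fin (k + 1) → ι) :
    covDeriv b G T x a =
      tensorDeriv (fun d e => christoffel b G d (a 0) e x) (b (a 0)) T x (Fin.tail a) := rfl

section

variable (A : ι → ι → ℝ) (v : V) (x : V)

theorem tensorDeriv_reindex {S Q : Type} [Fintype S] [DecidableEq S] [Fintype Q] [DecidableEq Q]
    (e : Q ≃ S) (T : V → (Q → ι) → ℝ) (a : S → ι) :
    tensorDeriv A v (fun y a => T y (a ∘ e)) x a = tensorDeriv A v T x (a ∘ e) := by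
  unfold tensorDeriv
  congr 1
  rw [← e.sum_comp]
  simp [Function.update_comp_equiv]

theorem tensorDeriv_mul {S S' : Type} [Fintype S] [DecidableEq S] [Fintype S'] [DecidableEq S']
    (T : V → (S → ι) → ℝ) (T' : V → (S' → ι) → ℝ) (a : S ⊕ S' → ι)
    (hT : ∀ a, DifferentiableAt ℝ (fun y => T y a) x)
    (hT' : ∀ a, DifferentiableAt ℝ (fun y => T' y a) x) :
    tensorDeriv A v (fun y a => T y (a ∘ Sum.inl) * T' y (a ∘ Sum.inr)) x a =
      tensorDeriv A v T x (a ∘ Sum.inl) * T' x (a ∘ Sum.inr) +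
        T x (a ∘ Sum.inl) * tensorDeriv A v T' x (a ∘ Sum.inr) := by
  unfold tensorDeriv
  rw [fderiv_fun_mul (hT _) (hT' _), Fintype.sum_sum_type]
  have h1 : ∀ s d, Function.update a (Sum.inl s) d ∘ Sum.inl =
      Function.update (a ∘ Sum.inl) s d :=
    fun s d => Function.update_comp_eq_of_injective _ Sum.inl_injective _ _
  have h2 : ∀ s d, Function.update a (Sum.inr s) d ∘ Sum.inr =
      Function.update (a ∘ Sum.inr) s d :=
    fun s d => Function.update_comp_eq_of_injective _ Sum.inr_injective _ _
  have h3 : ∀ s d, Function.update a (Sum.inl s) d ∘ Sum.inr = a ∘ Sum.inr :=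
    fun s d => Function.update_comp_eq_of_notMem_range _ _ (by simp)
  have h4 : ∀ s d, Function.update a (Sum.inr s) d ∘ Sum.inl = a ∘ Sum.inl :=
    fun s d => Function.update_comp_eq_of_notMem_range _ _ (by simp)
  simp only [h1, h2, h3, h4, _root_.add_apply, _root_.smul_apply,
    smul_eq_mul, sub_mul, mul_sub, Finset.sum_mul, Finset.mul_sum, Function.comp_apply]
  simp only [mul_assoc, mul_left_comm (T x _)]
  ring

/-- The remaining factors are indexed by `{j // j ≠ i}`, to match the factors of
`IndexContraction.deriv`. -/
theorem tensorDeriv_prod {C : Type} [Fintype C] [DecidableEq C] {S : C → Type}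
    [∀ i, Fintype (S i)] [∀ i, DecidableEq (S i)] (T : ∀ i, V → (S i → ι) → ℝ)
    (a : (Σ i, S i) → ι) (hT : ∀ i a, DifferentiableAt ℝ (fun y => T i y a) x) :
    tensorDeriv A v (fun y a => ∏ i, T i y fun s => a ⟨i, s⟩) x a =
      ∑ i, tensorDeriv A v (T i) x (fun s => a ⟨i, s⟩) *
        ∏ j : {j // j ≠ i}, T j x fun s => a ⟨j, s⟩ := by
  have split : ∀ (i : C) (f : C → ℝ), ∏ j, f j = f i * ∏ j : {j // j ≠ i}, f j := fun i f => by
    rw [← Fintype.prod_eq_mul_prod_subtype_ne f i]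
  unfold tensorDeriv
  rw [Fintype.sum_sigma, fderiv_finsetProd fun i _ => hT i _]
  simp only [_root_.sum_apply, _root_.smul_apply, smul_eq_mul]
  rw [← Finset.sum_sub_distrib]
  refine Finset.sum_congr rfl fun i _ => ?_
  rw [sub_mul]
  congr 1
  · rw [mul_comm]
    congr 1
    rw [← Finset.prod_subtype (p := fun j => j ≠ i) (Finset.univ.erase i) (by simp)
      (fun j => T j x fun s => a ⟨j, s⟩)]
  · rw [Finset.sum_mul]
    refine Finset.sum_congr rfl fun s _ => ?_
    rw [Finset.sum_mul]
    refine Finset.sum_congr rfl fun d _ => ?_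
    rw [split i, mul_assoc]
    congr 2
    · congr 1
      exact Function.update_comp_eq_of_injective a sigma_mk_injective s d
    · refine Finset.prod_congr rfl fun j _ => ?_
      congr 1
      funext u
      exact Function.update_of_ne (fun h => j.2 (congrArg Sigma.fst h)) _ _

/-- A product of copies of a parallel tensor of rank two is parallel. -/
theorem tensorDeriv_prod_pair {P : Type} [Fintype P] [DecidableEq P] (h : V → ι → ι → ℝ)
    (hd : ∀ i j, DifferentiableAt ℝ (fun y => h y i j) x)
    (hh : ∀ i j, fderiv ℝ (fun y => h y i j) x v =
      ∑ d, A d i * h x d j + ∑ d, A d j * h x i d) (c : P × Fin 2 → ι) :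
    tensorDeriv A v (fun y c => ∏ p, h y (c (p, 0)) (c (p, 1))) x c = 0 := by
  have h1 := tensorDeriv_reindex A v x (Equiv.sigmaEquivProd P (Fin 2))
    (fun y (c : (Σ _ : P, Fin 2) → ι) => ∏ p, h y (c ⟨p, 0⟩) (c ⟨p, 1⟩)) c
  simp only [Function.comp_apply, Equiv.sigmaEquivProd_apply] at h1
  refine h1.trans ?_
  have h2 := tensorDeriv_prod A v x (S := fun _ : P => Fin 2)
    (fun _ y a => h y (a 0) (a 1)) (c ∘ Equiv.sigmaEquivProd P (Fin 2)) (fun _ _ => hd _ _)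
  refine h2.trans (Finset.sum_eq_zero fun i _ => ?_)
  simp [tensorDeriv, hh, Fin.sum_univ_two]

/-- Contraction of the slots `R` with a contravariant tensor field `W`. -/
theorem tensorDeriv_contract {K R : Type} [Fintype K] [DecidableEq K] [Fintype R] [DecidableEq R]
    (W : V → (R → ι) → ℝ) (T : V → (K ⊕ R → ι) → ℝ) (a : K → ι)
    (hW : ∀ a, DifferentiableAt ℝ (fun y => W y a) x)
    (hT : ∀ a, DifferentiableAt ℝ (fun y => T y a) x) :
    tensorDeriv A v (fun y a => ∑ c, W y c * T y (Sum.elim a c)) x a =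
      ∑ c, W x c * tensorDeriv A v T x (Sum.elim a c) +
        ∑ c, tensorDeriv (fun d e => -A e d) v W x c * T x (Sum.elim a c) := by
  -- Summation by parts: the connection terms of the contracted slots move from `T` to `W`, where
  -- the connection matrix becomes its negative transpose.
  have swap : ∑ c, W x c * ∑ s, ∑ d, A d (c s) * T x (Sum.elim a (Function.update c s d)) =
      ∑ c, (∑ s, ∑ d, A (c s) d * W x (Function.update c s d)) * T x (Sum.elim a c) := by
    simp only [Finset.mul_sum, Finset.sum_mul]
    rw [Finset.sum_comm]
    conv_rhs => rw [Finset.sum_comm]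
    refine Finset.sum_congr rfl fun s _ => ?_
    rw [← Fintype.sum_prod_type', ← Fintype.sum_prod_type']
    -- The involution exchanges the dummy index d with the value of c at the slot s.
    let e : (R → ι) × ι → (R → ι) × ι := fun q => (Function.update q.1 s q.2, q.1 s)
    have he : Function.Involutive e := fun q => by simp [e]
    refine (Equiv.sum_comp he.toPerm _).symm.trans (Finset.sum_congr rfl fun q _ => ?_)
    simp [e, Function.Involutive.coe_toPerm]
    ring
  unfold tensorDeriv
  rw [fderiv_sum_mul_apply hW fun c => hT (Sum.elim a c)]
  simp only [
    Fintype.sum_sum_type, Sum.elim_inl, Sum.elim_inr, Sum.update_elim_inl, Sum.update_elim_inr,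
    mul_sub, mul_add, sub_mul, Finset.sum_add_distrib, Finset.sum_sub_distrib, neg_mul,
    Finset.sum_neg_distrib, swap]
  have hK : ∑ s, ∑ d, A d (a s) * ∑ c, W x c * T x (Sum.elim (Function.update a s d) c) =
      ∑ c, W x c * ∑ s, ∑ d, A d (a s) * T x (Sum.elim (Function.update a s d) c) := by
    simp only [Finset.mul_sum]
    simp only [Finset.sum_comm (γ := R → ι)]
    exact Finset.sum_congr rfl fun _ _ => Finset.sum_congr rfl fun _ _ =>
      Finset.sum_congr rfl fun _ _ => by ring
  rw [hK]
  simp only [mul_comm (T x _)]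
  ring

end

end TensorDerivative

/-! ### Partial contractions with arbitrary index types: differentiation and rewiring. -/

/-- A partial contraction with free slots `K` whose factors and contracted pairs are indexed by
arbitrary finite types. -/
structure IndexContraction (K : Type) where
  Curv : Type
  Met : Type
  Pair : Type
  [fintypeCurv : Fintype Curv]
  [decEqCurv : DecidableEq Curv]
  [fintypeMet : Fintype Met]
  [decEqMet : DecidableEq Met]
  [fintypePair : Fintype Pair]
  [decEqPair : DecidableEq Pair]
  order : Curv → ℕ
  slots : ((Σ i : Curv, Fin (4 + order i)) ⊕ (Met × Fin 2)) ≃ K ⊕ (Pair × Fin 2)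

namespace IndexContraction

attribute [instance] fintypeCurv decEqCurv fintypeMet decEqMet fintypePair decEqPair

variable {K : Type}

/-- The value of a contraction at the free indices `a`. -/
noncomputable def eval {ι V : Type} [Fintype ι] [DecidableEq ι] [NormedAddCommGroup V]
    [NormedSpace ℝ V] (m : IndexContraction K) (b : Module.Basis ι ℝ V) (G : V → Matrix ι ι ℝ) :
    V → (K → ι) → ℝ := fun x a =>
  ∑ c : m.Pair × Fin 2 → ι, (∏ p, (G x)⁻¹ (c (p, 0)) (c (p, 1)))
    * ((∏ i, nablaRiemann b G (m.order i) x fun s => Sum.elim a c (m.slots (Sum.inl ⟨i, s⟩)))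
    * ∏ l, G x (Sum.elim a c (m.slots (Sum.inr (l, 0))))
        (Sum.elim a c (m.slots (Sum.inr (l, 1)))))

/-- It suffices to number the three finite index types. The contraction `m'` is chosen before the
coordinate space, so it serves every dimension. -/
theorem exists_partialContraction {k : ℕ} (m : IndexContraction (Fin k)) :
    ∃ m' : PartialContraction k, ∀ (ι V : Type) [Fintype ι] [DecidableEq ι]
      [NormedAddCommGroup V] [NormedSpace ℝ V] (b : Module.Basis ι ℝ V) (G : V → Matrix ι ι ℝ)
      (x : V) (a : Fin k → ι), m'.eval b G x a = m.eval b G x a := by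
  let εC := (Fintype.equivFin m.Curv).symm
  let εM := (Fintype.equivFin m.Met).symm
  let εP := (Fintype.equivFin m.Pair).symm
  let eC : (Σ i, Fin (4 + m.order (εC i))) ≃ Σ i, Fin (4 + m.order i) :=
    Equiv.sigmaCongrLeft (β := fun i => Fin (4 + m.order i)) εC
  let eP := εP.prodCongr (Equiv.refl (Fin 2))
  refine ⟨⟨_, fun i => m.order (εC i), _, _,
    (eC.sumCongr (εM.prodCongr (Equiv.refl (Fin 2)))).trans
      (m.slots.trans ((Equiv.refl (Fin k)).sumCongr eP.symm))⟩, ?_⟩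
  intro ι V _ _ _ _ b G x a
  have hS : ∀ (c : Fin (Fintype.card m.Pair) × Fin 2 → ι) z, Sum.elim a c
      ((Equiv.refl (Fin k)).sumCongr eP.symm z) = Sum.elim a (c ∘ eP.symm) z := by
    rintro c (z | z) <;> rfl
  unfold PartialContraction.eval IndexContraction.eval
  refine Fintype.sum_equiv (Equiv.arrowCongr eP (Equiv.refl ι)) _ _ fun c => ?_
  rw [mul_assoc]
  congr 1
  · refine Fintype.prod_equiv εP _ _ fun p => ?_
    simp [Equiv.arrowCongr, eP]
  congr 1
  · refine Fintype.prod_equiv εC _ _ fun i => ?_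
    congr 1
    funext s
    exact hS c _
  · refine Fintype.prod_equiv εM _ _ fun i => ?_
    exact congrArg₂ (G x) (hS c _) (hS c _)

/-- The order of the curvature factors after the `i`-th one has been differentiated. -/
def derivOrder (m : IndexContraction K) (i : m.Curv) : Option {j // j ≠ i} → ℕ
  | none => m.order i + 1
  | some j => m.order j

/-- The slots after the `i`-th curvature factor has been differentiated. -/
def derivSlot {k : ℕ} (m : IndexContraction (Fin k)) (i : m.Curv) :
    ((Σ o, Fin (4 + m.derivOrder i o)) ⊕ (m.Met × Fin 2)) → Fin (k + 1) ⊕ (m.Pair × Fin 2)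
  | .inl ⟨none, s⟩ => Fin.cases (n := 4 + m.order i)
      (motive := fun _ => Fin (k + 1) ⊕ (m.Pair × Fin 2)) (.inl 0)
      (fun u => Sum.map Fin.succ id (m.slots (.inl ⟨i, u⟩))) s
  | .inl ⟨some j, s⟩ => Sum.map Fin.succ id (m.slots (.inl ⟨j.1, s⟩))
  | .inr l => Sum.map Fin.succ id (m.slots (.inr l))

/-- The old slots, shifted by one, biject with everything except the free index 0, and the new
derivative slot, the first one of the factor `none`, takes that index. -/
theorem bijective_derivSlot {k : ℕ} (m : IndexContraction (Fin k)) (i : m.Curv) :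
    Function.Bijective (m.derivSlot i) := by
  let shift : Fin k ⊕ (m.Pair × Fin 2) → Fin (k + 1) ⊕ (m.Pair × Fin 2) := Sum.map Fin.succ id
  have hinj : ∀ {y z}, shift (m.slots y) = shift (m.slots z) ↔ y = z := fun {y z} =>
    ((Sum.map_injective.2 ⟨Fin.succ_injective k, Function.injective_id⟩).comp
      m.slots.injective).eq_iff
  have h0 : ∀ z, shift z ≠ .inl 0 := by
    rintro (z | z) h <;> simp [shift] at h
  have hnone : ∀ u : Fin (4 + m.order i),
      m.derivSlot i (.inl ⟨none, (Fin.succ u : Fin (4 + m.order i + 1))⟩) =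
        shift (m.slots (.inl ⟨i, u⟩)) := fun u => rfl
  have hzero : m.derivSlot i (.inl ⟨none, (0 : Fin (4 + m.order i + 1))⟩) = .inl 0 := rfl
  have hsome : ∀ (j : {j // j ≠ i}) s,
      m.derivSlot i (.inl ⟨some j, s⟩) = shift (m.slots (.inl ⟨j.1, s⟩)) := fun _ _ => rfl
  have hinr : ∀ l, m.derivSlot i (.inr l) = shift (m.slots (.inr l)) := fun _ => rfl
  have hcases : ∀ y : (Σ o, Fin (4 + m.derivOrder i o)) ⊕ (m.Met × Fin 2),
      y = .inl ⟨none, (0 : Fin (4 + m.order i + 1))⟩ ∨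
      (∃ u : Fin (4 + m.order i), y = .inl ⟨none, (Fin.succ u : Fin (4 + m.order i + 1))⟩) ∨
      (∃ (j : {j // j ≠ i}) (s : Fin (4 + m.derivOrder i (some j))), y = .inl ⟨some j, s⟩) ∨
      ∃ l, y = .inr l := by
    rintro (⟨_ | j, s⟩ | l)
    · refine Fin.cases (n := 4 + m.order i) (Or.inl rfl) (fun u => Or.inr (Or.inl ⟨u, rfl⟩)) s
    · exact Or.inr (Or.inr (Or.inl ⟨j, s, rfl⟩))
    · exact Or.inr (Or.inr (Or.inr ⟨l, rfl⟩))
  constructor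
  · intro y z h
    rcases hcases y with rfl | ⟨u, rfl⟩ | ⟨j, s, rfl⟩ | ⟨l, rfl⟩ <;>
    rcases hcases z with rfl | ⟨u', rfl⟩ | ⟨j', s', rfl⟩ | ⟨l', rfl⟩
    · rfl
    · exact absurd (hzero.symm.trans (h.trans (hnone u'))).symm (h0 _)
    · exact absurd (hzero.symm.trans (h.trans (hsome j' s'))).symm (h0 _)
    · exact absurd (hzero.symm.trans (h.trans (hinr l'))).symm (h0 _)
    · exact absurd ((hnone u).symm.trans (h.trans hzero)) (h0 _)
    · cases hinj.1 ((hnone u).symm.trans (h.trans (hnone u')))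
      rfl
    · have h1 := Sum.inl_injective (hinj.1 ((hnone u).symm.trans (h.trans (hsome j' s'))))
      exact absurd (congrArg Sigma.fst h1).symm j'.2
    · cases hinj.1 ((hnone u).symm.trans (h.trans (hinr l')))
    · exact absurd ((hsome j s).symm.trans (h.trans hzero)) (h0 _)
    · have h1 := Sum.inl_injective (hinj.1 ((hsome j s).symm.trans (h.trans (hnone u'))))
      exact absurd (congrArg Sigma.fst h1) j.2
    · obtain ⟨j, hj⟩ := j
      obtain ⟨j', hj'⟩ := j'
      cases hinj.1 ((hsome _ s).symm.trans (h.trans (hsome _ s')))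
      rfl
    · cases hinj.1 ((hsome j s).symm.trans (h.trans (hinr l')))
    · exact absurd ((hinr l).symm.trans (h.trans hzero)) (h0 _)
    · cases hinj.1 ((hinr l).symm.trans (h.trans (hnone u')))
    · cases hinj.1 ((hinr l).symm.trans (h.trans (hsome j' s')))
    · cases hinj.1 ((hinr l).symm.trans (h.trans (hinr l')))
      rfl
  · intro z
    have hz : z = .inl 0 ∨ ∃ y, z = shift (m.slots y) := by
      rcases z with z | z
      · refine Fin.cases (Or.inl rfl) (fun u => Or.inr ⟨m.slots.symm (.inl u), ?_⟩) z
        simp [shift]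
      · exact Or.inr ⟨m.slots.symm (.inr z), by simp [shift]⟩
    rcases hz with rfl | ⟨⟨j, s⟩ | l, rfl⟩
    · exact ⟨_, hzero⟩
    · by_cases hj : j = i
      · subst hj
        exact ⟨_, hnone s⟩
      · exact ⟨_, hsome ⟨j, hj⟩ s⟩
    · exact ⟨_, hinr l⟩

/-- The contraction obtained by differentiating the `i`-th curvature factor; the index of the
derivative becomes the first free index. -/
noncomputable def deriv {k : ℕ} (m : IndexContraction (Fin k)) (i : m.Curv) :
    IndexContraction (Fin (k + 1)) where
  Curv := Option {j // j ≠ i}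
  Met := m.Met
  Pair := m.Pair
  order := m.derivOrder i
  slots := Equiv.ofBijective _ (m.bijective_derivSlot i)

section

variable {ι V : Type} [Fintype ι] [DecidableEq ι] [NormedAddCommGroup V] [NormedSpace ℝ V]

/-- The factor `none` has order `m.order i + 1`, so by definition it is a covariant derivative,
whose direction is the new free index `a 0`. -/
theorem eval_deriv {k : ℕ} (m : IndexContraction (Fin k)) (i : m.Curv) (b : Module.Basis ι ℝ V)
    (G : V → Matrix ι ι ℝ) (x : V) (a : Fin (k + 1) → ι) :
    (m.deriv i).eval b G x a =
      ∑ c : m.Pair × Fin 2 → ι, (∏ p, (G x)⁻¹ (c (p, 0)) (c (p, 1))) *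
        ((tensorDeriv (fun d e => christoffel b G d (a 0) e x) (b (a 0))
          (nablaRiemann b G (m.order i)) x
            (fun s => Sum.elim (Fin.tail a) c (m.slots (Sum.inl ⟨i, s⟩))) *
          ∏ j : {j // j ≠ i}, nablaRiemann b G (m.order j) x fun s =>
            Sum.elim (Fin.tail a) c (m.slots (Sum.inl ⟨j, s⟩))) *
        ∏ l, G x (Sum.elim (Fin.tail a) c (m.slots (Sum.inr (l, 0))))
          (Sum.elim (Fin.tail a) c (m.slots (Sum.inr (l, 1))))) := by
  have hS : ∀ (c : m.Pair × Fin 2 → ι) z, Sum.elim a c (Sum.map Fin.succ id z) =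
      Sum.elim (Fin.tail a) c z := by
    rintro c (z | z) <;> rfl
  unfold IndexContraction.eval
  refine Finset.sum_congr rfl fun c _ => ?_
  congr 2
  · refine (Fintype.prod_option _).trans ?_
    congr 1
    · refine (covDeriv_eq_tensorDeriv b G (nablaRiemann b G (m.order i)) x _).trans ?_
      refine congrArg (tensorDeriv _ _ _ _) (funext fun s => ?_)
      exact hS c _
    · refine Finset.prod_congr rfl fun j _ => ?_
      exact congrArg (nablaRiemann b G (m.order j) x) (funext fun s => hS c _)
  · refine Finset.prod_congr rfl fun l _ => ?_
    exact congrArg₂ (G x) (hS c _) (hS c _)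

/-- The Leibniz rule for a partial contraction. -/
theorem covDeriv_eval {k : ℕ} (m : IndexContraction (Fin k)) (b : Module.Basis ι ℝ V)
    {G : V → Matrix ι ι ℝ} {Ω : Set V} (hG : IsMetricOn Ω G) {x : V} (hx : x ∈ Ω)
    (a : Fin (k + 1) → ι) :
    covDeriv b G (m.eval b G) x a = ∑ i, (m.deriv i).eval b G x a := by
  have hR : ∀ (N : ℕ) a, DifferentiableAt ℝ (fun y => nablaRiemann b G N y a) x := fun N =>
    (hG.isSmoothOn_nablaRiemann b N).differentiableAt hG.isOpen hx
  rw [covDeriv_eq_tensorDeriv]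
  set A : ι → ι → ℝ := fun d e => christoffel b G d (a 0) e x with hA
  let W : V → (m.Pair × Fin 2 → ι) → ℝ := fun y c => ∏ p, (G y)⁻¹ (c (p, 0)) (c (p, 1))
  let F₁ : V → ((Σ i : m.Curv, Fin (4 + m.order i)) → ι) → ℝ := fun y a =>
    ∏ i, nablaRiemann b G (m.order i) y fun s => a ⟨i, s⟩
  let F₂ : V → (m.Met × Fin 2 → ι) → ℝ := fun y a => ∏ l, G y (a (l, 0)) (a (l, 1))
  let F : V → ((Σ i : m.Curv, Fin (4 + m.order i)) ⊕ (m.Met × Fin 2) → ι) → ℝ := fun y a =>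
    F₁ y (a ∘ Sum.inl) * F₂ y (a ∘ Sum.inr)
  have hW : ∀ c, DifferentiableAt ℝ (fun y => W y c) x := fun c => by
    simp only [W]
    exact (HasFDerivAt.finsetProd fun p _ =>
      (hG.differentiableAt_inv hx (c (p, 0)) (c (p, 1))).hasFDerivAt).differentiableAt
  have hF₁ : ∀ c, DifferentiableAt ℝ (fun y => F₁ y c) x := fun c => by
    simp only [F₁]
    exact (HasFDerivAt.finsetProd fun i _ =>
      (hR (m.order i) fun s => c ⟨i, s⟩).hasFDerivAt).differentiableAt
  have hF₂ : ∀ c, DifferentiableAt ℝ (fun y => F₂ y c) x := fun c => by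
    simp only [F₂]
    exact (HasFDerivAt.finsetProd fun l _ =>
      (hG.differentiableAt hx (c (l, 0)) (c (l, 1))).hasFDerivAt).differentiableAt
  -- The inverse metric is treated as a covariant tensor for the dual connection matrix -Aᵀ; this is
  -- the form in which `tensorDeriv_contract` needs it parallel.
  have hWpar : ∀ c, tensorDeriv (fun d e => -A e d) (b (a 0)) W x c = 0 := fun c =>
    tensorDeriv_prod_pair _ _ x (fun y i j => (G y)⁻¹ i j) (hG.differentiableAt_inv hx)
      (fun i j => by
        simpa [hA, Finset.sum_neg_distrib, partialDeriv, add_comm] using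
          hG.partialDeriv_inv_eq b hx (a 0) i j) c
  have hF₂par : ∀ c, tensorDeriv A (b (a 0)) F₂ x c = 0 := fun c =>
    tensorDeriv_prod_pair _ _ x (fun y i j => G y i j) (hG.differentiableAt hx)
      (fun i j => hG.partialDeriv_eq b hx (a 0) i j) c
  have h1 := tensorDeriv_contract A (b (a 0)) x W (fun y a => F y (a ∘ m.slots)) (Fin.tail a) hW
    fun c => (hF₁ _).fun_mul (hF₂ _)
  refine h1.trans ?_
  simp only [hWpar, zero_mul, Finset.sum_const_zero, add_zero, eval_deriv,
    tensorDeriv_reindex A (b (a 0)) x m.slots F]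
  rw [Finset.sum_comm]
  refine Finset.sum_congr rfl fun c _ => ?_
  rw [← Finset.mul_sum, ← Finset.sum_mul]
  congr 1
  refine (tensorDeriv_mul A (b (a 0)) x F₁ F₂ _ hF₁ hF₂).trans ?_
  rw [hF₂par, mul_zero, add_zero]
  congr 1
  exact tensorDeriv_prod A (b (a 0)) x (fun i => nablaRiemann b G (m.order i)) _ fun i => hR _

end

/-- Renaming the free slots. -/
def reindex {K' : Type} (m : IndexContraction K) (f : K ≃ K') : IndexContraction K' where
  Curv := m.Curv
  Met := m.Met
  Pair := m.Pair
  order := m.order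
  slots := m.slots.trans (f.sumCongr (Equiv.refl _))

/-- The slots of the contracted pairs after one more pair has been contracted. -/
def pairEquiv (P : Type) : Fin 2 ⊕ (P × Fin 2) ≃ (Unit ⊕ P) × Fin 2 :=
  ((Equiv.uniqueProd (Fin 2) Unit).symm.sumCongr (Equiv.refl _)).trans
    (Equiv.sumProdDistrib Unit P (Fin 2)).symm

/-- Contracting two free slots. -/
def contract {K' : Type} (m : IndexContraction K) (f : K ≃ K' ⊕ Fin 2) : IndexContraction K' where
  Curv := m.Curv
  Met := m.Met
  Pair := Unit ⊕ m.Pair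
  order := m.order
  slots := m.slots.trans <| (f.sumCongr (Equiv.refl _)).trans <|
    (Equiv.sumAssoc K' (Fin 2) _).trans ((Equiv.refl K').sumCongr (pairEquiv m.Pair))

variable {ι V : Type} [Fintype ι] [DecidableEq ι] [NormedAddCommGroup V] [NormedSpace ℝ V]

theorem eval_reindex {K' : Type} (m : IndexContraction K) (f : K ≃ K') (b : Module.Basis ι ℝ V)
    (G : V → Matrix ι ι ℝ) (x : V) (a : K' → ι) :
    (m.reindex f).eval b G x a = m.eval b G x (a ∘ f) := by
  have hS : ∀ (c : m.Pair × Fin 2 → ι) z, Sum.elim a c (f.sumCongr (Equiv.refl _) z) =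
      Sum.elim (a ∘ f) c z := by
    rintro c (z | z) <;> rfl
  unfold IndexContraction.eval
  refine Finset.sum_congr rfl fun c _ => ?_
  congr 2
  · exact Finset.prod_congr rfl fun i _ =>
      congrArg (nablaRiemann b G (m.order i) x) (funext fun s => hS c _)
  · exact Finset.prod_congr rfl fun l _ => congrArg₂ (G x) (hS c _) (hS c _)

theorem eval_contract {K' : Type} (m : IndexContraction K) (f : K ≃ K' ⊕ Fin 2)
    (b : Module.Basis ι ℝ V) (G : V → Matrix ι ι ℝ) (x : V) (a : K' → ι) :
    (m.contract f).eval b G x a =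
      ∑ i, ∑ j, (G x)⁻¹ i j * m.eval b G x (Sum.elim a ![i, j] ∘ f) := by
  have hS : ∀ (u : Fin 2 → ι) (c : m.Pair × Fin 2 → ι) z,
      Sum.elim a (Sum.elim u c ∘ (pairEquiv m.Pair).symm) ((m.contract f).slots z) =
      Sum.elim (Sum.elim a u ∘ f) c (m.slots z) := by
    intro u c z
    change Sum.elim a (Sum.elim u c ∘ (pairEquiv m.Pair).symm)
      ((Equiv.refl K').sumCongr (pairEquiv m.Pair) (Equiv.sumAssoc K' (Fin 2) _
        (f.sumCongr (Equiv.refl _) (m.slots z)))) = _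
    rcases m.slots z with z | z
    · rcases h : f z with y | y <;> simp [h]
    · simp
  have h2 : ∀ g : (Fin 2 → ι) → ℝ, ∑ u, g u = ∑ i, ∑ j, g ![i, j] := fun g => by
    rw [← Fintype.sum_prod_type']
    exact Fintype.sum_equiv (finTwoArrowEquiv ι) _ _ fun u => by
      congr 1; ext s; fin_cases s <;> rfl
  calc _ = ∑ u : Fin 2 → ι, (G x)⁻¹ (u 0) (u 1) * m.eval b G x (Sum.elim a u ∘ f) := by
        unfold IndexContraction.eval
        simp only [Finset.mul_sum]
        rw [← Fintype.sum_prod_type']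
        -- An assignment of values to the contracted slots splits into `u` on the new pair and `c`
        -- on the old ones.
        refine (Fintype.sum_equiv ((Equiv.sumArrowEquivProdArrow _ _ _).symm.trans
          (Equiv.arrowCongr (pairEquiv m.Pair) (Equiv.refl ι))) _ _ fun q => ?_).symm
        change _ = (∏ p, (G x)⁻¹ ((Sum.elim q.1 q.2 ∘ (pairEquiv m.Pair).symm) (p, 0))
          ((Sum.elim q.1 q.2 ∘ (pairEquiv m.Pair).symm) (p, 1))) * (
            (∏ i, nablaRiemann b G (m.order i) x fun s =>
              Sum.elim a (Sum.elim q.1 q.2 ∘ (pairEquiv m.Pair).symm)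
                ((m.contract f).slots (Sum.inl ⟨i, s⟩))) *
            ∏ l, G x (Sum.elim a (Sum.elim q.1 q.2 ∘ (pairEquiv m.Pair).symm)
                ((m.contract f).slots (Sum.inr (l, 0))))
              (Sum.elim a (Sum.elim q.1 q.2 ∘ (pairEquiv m.Pair).symm)
                ((m.contract f).slots (Sum.inr (l, 1)))))
        simp only [hS]
        rw [← mul_assoc]
        congr 1
        refine Eq.trans ?_ (Fintype.prod_sum_type _).symm
        congr 1
        simp [pairEquiv]
    _ = _ := h2 _

end IndexContraction

/-! ### Locality of derivatives, and closure of invariants under the tensor operations. -/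

section Congruence

variable {ι V : Type} [Fintype ι] [DecidableEq ι] [NormedAddCommGroup V] [NormedSpace ℝ V]

theorem partialDeriv_congr (b : Module.Basis ι ℝ V) (i : ι) {Ω : Set V} (hΩ : IsOpen Ω) {x : V}
    (hx : x ∈ Ω) {f g : V → ℝ} (h : ∀ y ∈ Ω, f y = g y) :
    partialDeriv b i f x = partialDeriv b i g x := by
  have h' : f =ᶠ[nhds x] g := by filter_upwards [hΩ.mem_nhds hx] with y hy using h y hy
  rw [partialDeriv, partialDeriv, h'.fderiv_eq]

theorem covDeriv_congr {k : ℕ} (b : Module.Basis ι ℝ V) (G : V → Matrix ι ι ℝ) {Ω : Set V}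
    (hΩ : IsOpen Ω) {x : V} (hx : x ∈ Ω) {T T' : V → (Fin k → ι) → ℝ}
    (h : ∀ y ∈ Ω, ∀ a, T y a = T' y a) (a : Fin (k + 1) → ι) :
    covDeriv b G T x a = covDeriv b G T' x a := by
  unfold covDeriv
  simp only [h x hx]
  rw [partialDeriv_congr b _ hΩ hx fun y hy => h y hy (Fin.tail a)]

end Congruence

/-- A rule that assigns a tensor field of rank `k` to every field of matrices in coordinates. -/
abbrev TensorRule (k : ℕ) : Type 1 :=
  ∀ (ι V : Type) [Fintype ι] [DecidableEq ι] [NormedAddCommGroup V] [NormedSpace ℝ V],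
    Module.Basis ι ℝ V → (V → Matrix ι ι ℝ) → V → (Fin k → ι) → ℝ

/-- On metrics, the rule `F` is the evaluation of the Riemannian invariant `J`. -/
def RiemannianInvariant.Represents {k : ℕ} (J : RiemannianInvariant k) (F : TensorRule k) : Prop :=
  ∀ (ι V : Type) [Fintype ι] [DecidableEq ι] [NormedAddCommGroup V] [NormedSpace ℝ V]
    (b : Module.Basis ι ℝ V) (G : V → Matrix ι ι ℝ) (Ω : Set V), IsMetricOn Ω G →
    ∀ x ∈ Ω, ∀ a, J.eval b G x a = F ι V b G x a

/-- The rule `F` is the evaluation of a Riemannian invariant. -/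
def IsInvariantRule {k : ℕ} (F : TensorRule k) : Prop :=
  ∃ J : RiemannianInvariant k, J.Represents F

namespace IsInvariantRule

variable {k : ℕ}

theorem congr {F F' : TensorRule k} (hF : IsInvariantRule F)
    (h : ∀ (ι V : Type) [Fintype ι] [DecidableEq ι] [NormedAddCommGroup V] [NormedSpace ℝ V]
      (b : Module.Basis ι ℝ V) (G : V → Matrix ι ι ℝ) (Ω : Set V), IsMetricOn Ω G →
      ∀ x ∈ Ω, ∀ a, F ι V b G x a = F' ι V b G x a) : IsInvariantRule F' := by
  obtain ⟨J, hJ⟩ := hF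
  exact ⟨J, fun ι V _ _ _ _ b G Ω hG x hx a =>
    (hJ ι V b G Ω hG x hx a).trans (h ι V b G Ω hG x hx a)⟩

theorem of_eval (I : RiemannianInvariant k) :
    IsInvariantRule fun _ _ _ _ _ _ b G => I.eval b G :=
  ⟨I, fun _ _ _ _ _ _ _ _ _ _ _ _ _ => rfl⟩

theorem of_partialContraction (m : PartialContraction k) :
    IsInvariantRule fun _ _ _ _ _ _ b G => m.eval b G :=
  ⟨(Finsupp.single m 1 : PartialContraction k →₀ ℝ), fun ι V _ _ _ _ b G Ω _ x _ a => by
    simp [RiemannianInvariant.eval]⟩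

theorem of_indexContraction (m : IndexContraction (Fin k)) :
    IsInvariantRule fun _ _ _ _ _ _ b G => m.eval b G := by
  obtain ⟨m', hm'⟩ := m.exists_partialContraction
  exact (of_partialContraction m').congr fun ι V _ _ _ _ b G _ _ x _ a => hm' ι V b G x a

theorem zero : IsInvariantRule (fun _ _ _ _ _ _ _ _ _ _ => 0 : TensorRule k) :=
  ⟨(0 : PartialContraction k →₀ ℝ), fun _ _ _ _ _ _ _ _ _ _ _ _ _ =>
    Finsupp.sum_zero_index⟩

theorem add {F F' : TensorRule k} (hF : IsInvariantRule F) (hF' : IsInvariantRule F') :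
    IsInvariantRule fun ι V _ _ _ _ b G x a => F ι V b G x a + F' ι V b G x a := by
  obtain ⟨(J : PartialContraction k →₀ ℝ), hJ⟩ := hF
  obtain ⟨(J' : PartialContraction k →₀ ℝ), hJ'⟩ := hF'
  refine ⟨(J + J' : PartialContraction k →₀ ℝ),
    fun ι V _ _ _ _ b G Ω hG x hx a => ?_⟩
  exact (Finsupp.sum_add_index' (fun _ => zero_mul _) fun _ _ _ => add_mul _ _ _).trans
    (congrArg₂ (· + ·) (hJ ι V b G Ω hG x hx a) (hJ' ι V b G Ω hG x hx a))

theorem smul {F : TensorRule k} (r : ℝ) (hF : IsInvariantRule F) :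
    IsInvariantRule fun ι V _ _ _ _ b G x a => r * F ι V b G x a := by
  obtain ⟨(J : PartialContraction k →₀ ℝ), hJ⟩ := hF
  refine ⟨(r • J : PartialContraction k →₀ ℝ),
    fun ι V _ _ _ _ b G Ω hG x hx a => ?_⟩
  refine (Finsupp.sum_smul_index' fun _ => zero_mul _).trans
    (Eq.trans ?_ (congrArg (r * ·) (hJ ι V b G Ω hG x hx a)))
  simp only [smul_eq_mul, mul_assoc]
  exact (Finsupp.mul_sum _ _).symm

theorem sum {α : Type} (s : Finset α) {F : α → TensorRule k}
    (hF : ∀ i ∈ s, IsInvariantRule (F i)) :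
    IsInvariantRule fun ι V _ _ _ _ b G x a => ∑ i ∈ s, F i ι V b G x a := by
  classical
  induction s using Finset.induction_on with
  | empty => exact zero.congr (by simp)
  | insert i s hi ih =>
    refine ((hF i (Finset.mem_insert_self i s)).add
      (ih fun j hj => hF j (Finset.mem_insert_of_mem hj))).congr ?_
    intro ι V _ _ _ _ b G Ω hG x hx a
    simp only [Finset.sum_insert hi]

/-- The covariant derivative of an invariant is an invariant. -/
theorem covDeriv {F : TensorRule k} (hF : IsInvariantRule F) :
    IsInvariantRule fun ι V _ _ _ _ b G => covDeriv b G (F ι V b G) := by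
  obtain ⟨(J : PartialContraction k →₀ ℝ), hJ⟩ := hF
  have hm : ∀ m : PartialContraction k,
      IsInvariantRule fun ι V _ _ _ _ b G => _root_.covDeriv b G (m.eval b G) := fun m => by
    -- The same contraction; its value differs only in how the product is associated.
    let m' : IndexContraction (Fin k) := ⟨_, Fin m.numMetric, _, m.order, m.slots⟩
    refine (IsInvariantRule.sum Finset.univ fun i _ => of_indexContraction (m'.deriv i)).congr ?_
    intro ι V _ _ _ _ b G Ω hG x hx a
    refine (m'.covDeriv_eval b hG hx a).symm.trans ?_
    refine covDeriv_congr b G hG.isOpen hx (fun y _ a => ?_) a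
    exact Finset.sum_congr rfl fun c _ => (mul_assoc _ _ _).symm
  refine (IsInvariantRule.sum J.support fun m _ => (hm m).smul (J m)).congr ?_
  intro ι V _ _ _ _ b G Ω hG x hx a
  -- `J` and `F` agree on the whole open set, so `F` may be replaced under the derivative; linearity
  -- in the coefficients of `J` remains.
  rw [← covDeriv_congr b G hG.isOpen hx (hJ ι V b G Ω hG)]
  unfold _root_.covDeriv RiemannianInvariant.eval Finsupp.sum partialDeriv
  rw [fderiv_fun_sum fun m _ => ((hG.isSmoothOn_partialContraction b m).differentiableAt
    hG.isOpen hx _).const_mul _]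
  simp only [fderiv_const_mul ((hG.isSmoothOn_partialContraction b _).differentiableAt
    hG.isOpen hx _), _root_.sum_apply, _root_.smul_apply, smul_eq_mul, mul_sub,
    Finset.sum_sub_distrib, Finset.mul_sum]
  congr 1
  rw [Finset.sum_comm]
  refine Finset.sum_congr rfl fun s _ => ?_
  rw [Finset.sum_comm]
  exact Finset.sum_congr rfl fun d _ => Finset.sum_congr rfl fun m _ => by ring

/-- A metric contraction of an invariant is an invariant. -/
theorem contract {k' : ℕ} {F : TensorRule k} (hF : IsInvariantRule F)
    (f : Fin k ≃ Fin k' ⊕ Fin 2) : IsInvariantRule fun ι V _ _ _ _ b G x a =>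
      ∑ i, ∑ j, (G x)⁻¹ i j * F ι V b G x (Sum.elim a ![i, j] ∘ f) := by
  obtain ⟨(J : PartialContraction k →₀ ℝ), hJ⟩ := hF
  refine (IsInvariantRule.sum J.support fun m _ => (of_indexContraction
    (IndexContraction.contract ⟨_, Fin m.numMetric, _, m.order, m.slots⟩ f)).smul (J m)).congr ?_
  intro ι V _ _ _ _ b G Ω hG x hx a
  simp only [← hJ ι V b G Ω hG x hx, IndexContraction.eval_contract, RiemannianInvariant.eval,
    Finsupp.sum, Finset.mul_sum]
  rw [Finset.sum_comm]
  refine Finset.sum_congr rfl fun i _ => ?_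
  rw [Finset.sum_comm]
  refine Finset.sum_congr rfl fun j _ => Finset.sum_congr rfl fun m _ => ?_
  rw [mul_left_comm]
  congr 2
  exact Finset.sum_congr rfl fun c _ => (mul_assoc _ _ _).symm

theorem reindex {F : TensorRule k} (hF : IsInvariantRule F) (f : Fin k ≃ Fin k) :
    IsInvariantRule fun ι V _ _ _ _ b G x a => F ι V b G x (a ∘ f) := by
  obtain ⟨(J : PartialContraction k →₀ ℝ), hJ⟩ := hF
  refine (IsInvariantRule.sum J.support fun m _ => (of_indexContraction
    (IndexContraction.reindex ⟨_, Fin m.numMetric, _, m.order, m.slots⟩ f)).smul (J m)).congr ?_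
  intro ι V _ _ _ _ b G Ω hG x hx a
  simp only [← hJ ι V b G Ω hG x hx, IndexContraction.eval_reindex, RiemannianInvariant.eval,
    Finsupp.sum]
  refine Finset.sum_congr rfl fun m _ => ?_
  congr 1
  exact Finset.sum_congr rfl fun c _ => (mul_assoc _ _ _).symm

/-- The slots `0, …, q-1` are free, and the last two are contracted. -/
def _root_.lastTwoSlots (q : ℕ) : Fin (q + 2) → Fin q ⊕ Fin 2 :=
  Fin.snoc (Fin.snoc Sum.inl (Sum.inr 0) : Fin (q + 1) → Fin q ⊕ Fin 2) (Sum.inr 1)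

theorem _root_.bijective_lastTwoSlots (q : ℕ) : Function.Bijective (lastTwoSlots q) := by
  rw [Fintype.bijective_iff_surjective_and_card]
  refine ⟨?_, by simp⟩
  rintro (s | s)
  · exact ⟨s.castSucc.castSucc, by simp [lastTwoSlots]⟩
  · fin_cases s
    · exact ⟨(Fin.last q).castSucc, by simp [lastTwoSlots]⟩
    · exact ⟨Fin.last (q + 1), by simp [lastTwoSlots]⟩

theorem traceLast {q : ℕ} {F : TensorRule (q + 2)} (hF : IsInvariantRule F) :
    IsInvariantRule fun ι V _ _ _ _ b G => traceLast G (F ι V b G) := by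
  refine (hF.contract (Equiv.ofBijective _ (bijective_lastTwoSlots q))).congr ?_
  intro ι V _ _ _ _ b G Ω _ x _ a
  refine Finset.sum_congr rfl fun i _ => Finset.sum_congr rfl fun j _ => ?_
  congr 2
  simp only [Equiv.coe_ofBijective, lastTwoSlots]
  rw [Fin.comp_snoc, Fin.comp_snoc]
  rfl

/-- The first and the last slots are contracted, and the others are free. -/
def _root_.firstLastSlots (r : ℕ) : Fin (r + 2) → Fin r ⊕ Fin 2 :=
  Fin.cons (Sum.inr 0) (Fin.snoc Sum.inl (Sum.inr 1) : Fin (r + 1) → Fin r ⊕ Fin 2)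

theorem _root_.bijective_firstLastSlots (r : ℕ) : Function.Bijective (firstLastSlots r) := by
  rw [Fintype.bijective_iff_surjective_and_card]
  refine ⟨?_, by simp⟩
  rintro (s | s)
  · exact ⟨s.castSucc.succ, by simp [firstLastSlots]⟩
  · fin_cases s
    · exact ⟨0, by simp [firstLastSlots]⟩
    · exact ⟨(Fin.last r).succ, by simp only [firstLastSlots, Fin.cons_succ, Fin.snoc_last]; rfl⟩

theorem divergence {r : ℕ} {F : TensorRule (r + 1)} (hF : IsInvariantRule F) :
    IsInvariantRule fun ι V _ _ _ _ b G => divergence b G (F ι V b G) := by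
  refine (hF.covDeriv.contract (Equiv.ofBijective _ (bijective_firstLastSlots r))).congr ?_
  intro ι V _ _ _ _ b G Ω _ x _ a
  refine Finset.sum_congr rfl fun i _ => Finset.sum_congr rfl fun j _ => ?_
  congr 2
  simp only [Equiv.coe_ofBijective, firstLastSlots]
  rw [Fin.comp_cons, Fin.comp_snoc]
  rfl

theorem symmetrize {F : TensorRule k} (hF : IsInvariantRule F) :
    IsInvariantRule fun ι V _ _ _ _ b G => symmetrize (F ι V b G) :=
  (IsInvariantRule.sum Finset.univ fun σ _ => hF.reindex σ).smul (1 / (k.factorial : ℝ))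

theorem modifiedDivergence (w : ℝ) : ∀ {r : ℕ} {F : TensorRule (r + 1)}, IsInvariantRule F →
    IsInvariantRule fun ι V _ _ _ _ b G => modifiedDivergence b G w r (F ι V b G)
  | 0, _, hF => hF.divergence
  | _ + 1, _, hF => hF.divergence.add (hF.traceLast.covDeriv.symmetrize.smul _)

end IsInvariantRule

/-! ### From metrics on manifolds to their matrices in charts. -/

namespace PseudoRiemannianManifold

variable {n : ℕ} (X : PseudoRiemannianManifold n)

theorem Chart.mdifferentiable {X : PseudoRiemannianManifold n} (e : X.Chart) :
    e.1.MDifferentiable (𝓡 n) (𝓡 n) :=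
  ⟨(contMDiffOn_of_mem_maximalAtlas e.2).mdifferentiableOn (by simp),
    (contMDiffOn_symm_of_mem_maximalAtlas e.2).mdifferentiableOn (by simp)⟩

theorem gram_apply (e : X.Chart) (x : EuclideanSpace ℝ (Fin n)) (i j : Fin n) :
    X.gram e x i j = X.metric (e.1.symm x)
      (mfderiv (𝓡 n) (𝓡 n) e.1.symm x (stdFrame n i))
      (mfderiv (𝓡 n) (𝓡 n) e.1.symm x (stdFrame n j)) := rfl

theorem isMetricOn_gram (e : X.Chart) : IsMetricOn e.1.target (X.gram e) where
  isOpen := e.1.open_target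
  contDiffOn i j := X.smooth e.1 e.2 i j
  symm x _ i j := by rw [gram_apply, gram_apply, X.symmetric]
  isUnit_det x hx := by
    rw [isUnit_iff_ne_zero]
    intro hdet
    -- A kernel vector of the Gram matrix is the coordinate vector of a tangent vector orthogonal to
    -- the frame, hence to everything because `L` is onto; nondegeneracy and injectivity of `L` make
    -- it zero.
    obtain ⟨v, hv, hGv⟩ := Matrix.exists_mulVec_eq_zero_iff.2 hdet
    let L : EuclideanSpace ℝ (Fin n) →L[ℝ] TangentSpace (𝓡 n) (e.1.symm x) :=
      mfderiv (𝓡 n) (𝓡 n) e.1.symm x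
    have hL : Function.Bijective L := e.mdifferentiable.symm.mfderiv_bijective hx
    let u : EuclideanSpace ℝ (Fin n) := ∑ j, v j • stdFrame n j
    have h1 : ∀ i, X.metric (e.1.symm x) (L (stdFrame n i)) (L u) = 0 := fun i => by
      have := congrFun hGv i
      simp only [Matrix.mulVec, dotProduct, Pi.zero_apply, gram_apply] at this
      simp only [u, map_sum, map_smul, smul_eq_mul]
      rw [← this]
      exact Finset.sum_congr rfl fun j _ => mul_comm _ _
    have h2 : ∀ w, X.metric (e.1.symm x) (L u) w = 0 := fun w => by
      obtain ⟨w, rfl⟩ := hL.2 w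
      rw [X.symmetric, ← (stdFrame n).sum_repr w]
      simp only [map_sum, map_smul, FunLike.coe_sum, Finset.sum_apply,
        FunLike.coe_smul, Pi.smul_apply, h1, smul_zero, Finset.sum_const_zero]
    have h3 : u = 0 := hL.1 ((X.nondegenerate _ _ h2).trans (map_zero L).symm)
    exact hv (funext fun j => Fintype.linearIndependent_iff.1 (stdFrame n).linearIndependent v h3 j)

theorem metricComponents_smul (c : ℝ) (e : X.Chart) :
    metricComponents (𝓡 n) (stdFrame n) (fun p => c • X.metric p) e.1 =
      fun x => c • X.gram e x := rfl

/-- The ambient metric in the coordinates `(t, x, ρ)`, as a function of the components of `g`. -/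
def ambientMatrix (lam : ℝ) (G : EuclideanSpace ℝ (Fin n) → Matrix (Fin n) (Fin n) ℝ)
    (q : ℝ × EuclideanSpace ℝ (Fin n) × ℝ) : Matrix (AmbientIndex n) (AmbientIndex n) ℝ :=
  Matrix.of fun
    | .inl _, .inl _ => 2 * q.2.2
    | .inl _, .inr (.inr _) => q.1
    | .inr (.inr _), .inl _ => q.1
    | .inr (.inl i), .inr (.inl j) => (q.1 * (1 + lam * q.2.2)) ^ 2 * G q.2.1 i j
    | _, _ => 0

theorem ambientMetric_apply (lam : ℝ) (q : ℝ × X.carrier × ℝ)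
    (v u : ℝ × EuclideanSpace ℝ (Fin n) × ℝ) :
    X.ambientMetric lam q v u = 2 * q.2.2 * (v.1 * u.1) + q.1 * (v.1 * u.2.2 + v.2.2 * u.1)
      + (q.1 * (1 + lam * q.2.2)) ^ 2 * X.metric q.2.1 v.2.1 u.2.1 := rfl

/-- The inverse of the ambient chart is the product of the identity, the inverse of `e` and the
identity. -/
theorem mfderiv_ambientChart_symm (e : X.Chart) {q : ℝ × EuclideanSpace ℝ (Fin n) × ℝ}
    (hq : q.2.1 ∈ e.1.target) (v : ℝ × EuclideanSpace ℝ (Fin n) × ℝ) :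
    mfderiv 𝓘(ℝ, ℝ × EuclideanSpace ℝ (Fin n) × ℝ) (ambientModel n)
      ((X.ambientChart e).extend (ambientModel n)).symm q v =
    ((v.1, (mfderiv (𝓡 n) (𝓡 n) e.1.symm q.2.1 v.2.1 : EuclideanSpace ℝ (Fin n)), v.2.2) :
      ℝ × EuclideanSpace ℝ (Fin n) × ℝ) := by
  have h1 := (ContinuousLinearMap.fst ℝ ℝ (EuclideanSpace ℝ (Fin n) × ℝ)).hasFDerivAt
    (x := q) |>.hasMFDerivAt
  have h2 := ((ContinuousLinearMap.fst ℝ (EuclideanSpace ℝ (Fin n)) ℝ).comp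
    (ContinuousLinearMap.snd ℝ ℝ (EuclideanSpace ℝ (Fin n) × ℝ))).hasFDerivAt
    (x := q) |>.hasMFDerivAt
  have h3 := ((ContinuousLinearMap.snd ℝ (EuclideanSpace ℝ (Fin n)) ℝ).comp
    (ContinuousLinearMap.snd ℝ ℝ (EuclideanSpace ℝ (Fin n) × ℝ))).hasFDerivAt
    (x := q) |>.hasMFDerivAt
  have h4 : HasMFDerivAt (𝓡 n) (𝓡 n) e.1.symm q.2.1 (mfderiv (𝓡 n) (𝓡 n) e.1.symm q.2.1) :=
    (e.mdifferentiable.symm.mdifferentiableAt hq).hasMFDerivAt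
  have h5 := h1.prodMk ((HasMFDerivAt.comp q h4 h2).prodMk h3)
  exact congrArg (fun L : (ℝ × EuclideanSpace ℝ (Fin n) × ℝ →L[ℝ]
    ℝ × EuclideanSpace ℝ (Fin n) × ℝ) => L v) h5.mfderiv

/-- This reduces the ambient geometry to matrix calculus: the later computations with
`ambientMatrix` take an arbitrary metric `G` on an open subset of ℝⁿ. -/
theorem ambientGram_eq (lam : ℝ) (e : X.Chart) {q : ℝ × EuclideanSpace ℝ (Fin n) × ℝ}
    (hq : q.2.1 ∈ e.1.target) : X.ambientGram lam e q = ambientMatrix lam (X.gram e) q := by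
  ext A B
  have h : X.ambientGram lam e q A B = X.ambientMetric lam (q.1, e.1.symm q.2.1, q.2.2)
      (mfderiv 𝓘(ℝ, ℝ × EuclideanSpace ℝ (Fin n) × ℝ) (ambientModel n)
        ((X.ambientChart e).extend (ambientModel n)).symm q (ambientFrame n A))
      (mfderiv 𝓘(ℝ, ℝ × EuclideanSpace ℝ (Fin n) × ℝ) (ambientModel n)
        ((X.ambientChart e).extend (ambientModel n)).symm q (ambientFrame n B)) := rfl
  have h' := (X.ambientMetric_apply lam (q.1, e.1.symm q.2.1, q.2.2) _ _).symm.trans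
    (congrArg₂ (fun v u : ℝ × EuclideanSpace ℝ (Fin n) × ℝ =>
      X.ambientMetric lam (q.1, e.1.symm q.2.1, q.2.2) v u)
      (X.mfderiv_ambientChart_symm e hq (ambientFrame n A))
      (X.mfderiv_ambientChart_symm e hq (ambientFrame n B))).symm
  let L : EuclideanSpace ℝ (Fin n) →L[ℝ] TangentSpace (𝓡 n) (e.1.symm q.2.1) :=
    mfderiv (𝓡 n) (𝓡 n) e.1.symm q.2.1
  have hl : ∀ u : EuclideanSpace ℝ (Fin n), X.metric (e.1.symm q.2.1)
      (mfderiv (𝓡 n) (𝓡 n) e.1.symm q.2.1 (0 : EuclideanSpace ℝ (Fin n)))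
      (mfderiv (𝓡 n) (𝓡 n) e.1.symm q.2.1 u) = 0 := fun u => by
    change X.metric (e.1.symm q.2.1) (L 0) (L u) = 0
    simp
  have hr : ∀ u : EuclideanSpace ℝ (Fin n), X.metric (e.1.symm q.2.1)
      (mfderiv (𝓡 n) (𝓡 n) e.1.symm q.2.1 u)
      (mfderiv (𝓡 n) (𝓡 n) e.1.symm q.2.1 (0 : EuclideanSpace ℝ (Fin n))) = 0 := fun u => by
    rw [X.symmetric, hl]
  rw [h]
  refine h'.symm.trans ?_
  rcases A with A | A | A <;> rcases B with B | B | B <;>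
    simp [ambientFrame, ambientMatrix, gram_apply, hl, hr]

end PseudoRiemannianManifold

/-! ### Locality, symmetry and scaling of the modified divergence. -/

section ModifiedDivergence

variable {ι V : Type} [Fintype ι] [DecidableEq ι] [NormedAddCommGroup V] [NormedSpace ℝ V]
  (b : Module.Basis ι ℝ V) {Ω : Set V}

/-- The components of `T` are symmetric on `Ω`. -/
def IsSymmetricOn {S : Type} (Ω : Set V) (T : V → (S → ι) → ℝ) : Prop :=
  ∀ x ∈ Ω, ∀ (σ : Equiv.Perm S) a, T x (a ∘ σ) = T x a

theorem covDeriv_congr_metric {k : ℕ} {G G' : V → Matrix ι ι ℝ} (hΩ : IsOpen Ω)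
    (h : ∀ y ∈ Ω, G y = G' y) {x : V} (hx : x ∈ Ω) (T : V → (Fin k → ι) → ℝ)
    (a : Fin (k + 1) → ι) : covDeriv b G T x a = covDeriv b G' T x a := by
  have hd : ∀ i j l, partialDeriv b i (fun y => G y j l) x =
      partialDeriv b i (fun y => G' y j l) x := fun i j l =>
    partialDeriv_congr b i hΩ hx fun y hy => by rw [h y hy]
  simp only [covDeriv, christoffel, h x hx, hd]

/-- Equality on an open set is enough, which matters because the explicit form of the ambient metric
and the straightening of `T` are available only on the coordinate domain of the ambient space. -/
theorem modifiedDivergence_congr {G G' : V → Matrix ι ι ℝ} (hΩ : IsOpen Ω)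
    (hG : ∀ y ∈ Ω, G y = G' y) (w : ℝ) {r : ℕ} {T T' : V → (Fin (r + 1) → ι) → ℝ}
    (hT : ∀ y ∈ Ω, ∀ a, T y a = T' y a) {x : V} (hx : x ∈ Ω) (a : Fin r → ι) :
    modifiedDivergence b G w r T x a = modifiedDivergence b G' w r T' x a := by
  have hdiv : divergence b G T x a = divergence b G' T' x a := by
    simp only [divergence, hG x hx, covDeriv_congr_metric b hΩ hG hx,
      covDeriv_congr b G' hΩ hx hT]
  cases r with
  | zero => exact hdiv
  | succ q =>
    have htr : ∀ y ∈ Ω, ∀ a, traceLast G T y a = traceLast G' T' y a := fun y hy a => by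
      simp only [traceLast, hG y hy, hT y hy]
    simp only [modifiedDivergence, hdiv, symmetrize, covDeriv_congr_metric b hΩ hG hx,
      covDeriv_congr b G' hΩ hx htr]

theorem covDeriv_cons_comp_perm {k : ℕ} (G : V → Matrix ι ι ℝ) (hΩ : IsOpen Ω)
    {T : V → (Fin k → ι) → ℝ} {σ : Equiv.Perm (Fin k)}
    (hT : ∀ y ∈ Ω, ∀ a, T y (a ∘ σ) = T y a) {x : V} (hx : x ∈ Ω) (i : ι) (a : Fin k → ι) :
    covDeriv b G T x (Fin.cons i (a ∘ σ) : Fin (k + 1) → ι) =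
      covDeriv b G T x (Fin.cons i a : Fin (k + 1) → ι) := by
  rw [← covDeriv_congr b G hΩ hx hT (Fin.cons i a)]
  exact (tensorDeriv_reindex (fun d e => christoffel b G d i e x) (b i) x σ T a).symm

/-- The permutation of `0, …, r` that fixes `r` and acts on the others as `σ`. -/
def snocPerm {r : ℕ} (σ : Equiv.Perm (Fin r)) : Equiv.Perm (Fin (r + 1)) :=
  finSuccEquivLast.symm.permCongr σ.optionCongr

theorem snoc_comp_perm {α : Type} {r : ℕ} (σ : Equiv.Perm (Fin r)) (a : Fin r → α) (j : α) :
    (Fin.snoc (a ∘ σ) j : Fin (r + 1) → α) = (Fin.snoc a j : Fin (r + 1) → α) ∘ snocPerm σ := by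
  funext s
  refine Fin.lastCases ?_ (fun s => ?_) s
  · simp [snocPerm, Equiv.permCongr_apply]
  · simp [snocPerm, Equiv.permCongr_apply]

/-- For the divergence, a permutation of the free slots extends to one of the slots of `T` fixing
the contracted last slot. The other term is a symmetrization, where σ is absorbed by the sum over
permutations. -/
theorem modifiedDivergence_comp_perm (G : V → Matrix ι ι ℝ) (hΩ : IsOpen Ω) (w : ℝ) {r : ℕ}
    {T : V → (Fin (r + 1) → ι) → ℝ} (hT : IsSymmetricOn Ω T) {x : V} (hx : x ∈ Ω)
    (σ : Equiv.Perm (Fin r)) (a : Fin r → ι) :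
    modifiedDivergence b G w r T x (a ∘ σ) = modifiedDivergence b G w r T x a := by
  have hdiv : divergence b G T x (a ∘ σ) = divergence b G T x a := by
    simp only [divergence, snoc_comp_perm, covDeriv_cons_comp_perm b G hΩ
      (fun y hy a => hT y hy (snocPerm σ) a) hx]
  cases r with
  | zero => exact hdiv
  | succ q =>
    simp only [modifiedDivergence, hdiv, symmetrize]
    congr 3
    exact Fintype.sum_equiv (Equiv.mulLeft σ) _ _ fun _ => rfl

theorem IsMetricOn.inv_smul {G : V → Matrix ι ι ℝ} (hG : IsMetricOn Ω G) {s : ℝ} (hs : s ≠ 0)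
    {x : V} (hx : x ∈ Ω) : (s • G x)⁻¹ = s⁻¹ • (G x)⁻¹ := by
  refine Matrix.inv_eq_right_inv ?_
  rw [Matrix.smul_mul, Matrix.mul_smul, smul_smul, mul_inv_cancel₀ hs, one_smul,
    Matrix.mul_nonsing_inv _ (hG.isUnit_det x hx)]

theorem IsMetricOn.smul {G : V → Matrix ι ι ℝ} (hG : IsMetricOn Ω G) {s : ℝ} (hs : s ≠ 0) :
    IsMetricOn Ω fun x => s • G x where
  isOpen := hG.isOpen
  contDiffOn i j := contDiffOn_const.mul (hG.contDiffOn i j)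
  symm x hx i j := by simp only [Matrix.smul_apply, hG.symm x hx i j]
  isUnit_det x hx := by
    rw [Matrix.det_smul]
    exact (isUnit_iff_ne_zero.2 (pow_ne_zero _ hs)).mul (hG.isUnit_det x hx)

/-- In the Christoffel symbols the constant from the differentiated metric cancels the one from the
inverse metric. -/
theorem IsMetricOn.covDeriv_smul_metric {G : V → Matrix ι ι ℝ} (hG : IsMetricOn Ω G) {s : ℝ}
    (hs : s ≠ 0) {k : ℕ} (T : V → (Fin k → ι) → ℝ) {x : V} (hx : x ∈ Ω) (a : Fin (k + 1) → ι) :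
    covDeriv b (fun y => s • G y) T x a = covDeriv b G T x a := by
  have hd : ∀ i j l, partialDeriv b i (fun y => s * G y j l) x =
      s * partialDeriv b i (fun y => G y j l) x := fun i j l => by
    simp only [partialDeriv, smul_eq_mul, fderiv_const_mul (hG.differentiableAt hx j l), _root_.smul_apply]
  have hΓ : ∀ c i j, christoffel b (fun y => s • G y) c i j x = christoffel b G c i j x :=
    fun c i j => by
      simp only [christoffel, hG.inv_smul hs hx, Matrix.smul_apply, smul_eq_mul, hd]
      congr 1
      refine Finset.sum_congr rfl fun l _ => ?_
      field_simp
  simp only [covDeriv, hΓ]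

theorem covDeriv_const_mul {k : ℕ} (G : V → Matrix ι ι ℝ) (c : ℝ) {T : V → (Fin k → ι) → ℝ}
    {x : V} (hT : ∀ a, DifferentiableAt ℝ (fun y => T y a) x) (a : Fin (k + 1) → ι) :
    covDeriv b G (fun y a => c * T y a) x a = c * covDeriv b G T x a := by
  simp only [covDeriv, partialDeriv, fderiv_const_mul (hT _), _root_.smul_apply, smul_eq_mul,
    mul_sub, Finset.mul_sum, mul_left_comm c]

/-- Both terms contain exactly one inverse metric outside the connection, which accounts for the
single factor `s⁻¹`. -/
theorem IsMetricOn.modifiedDivergence_smul {G : V → Matrix ι ι ℝ} (hG : IsMetricOn Ω G) {s : ℝ}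
    (hs : s ≠ 0) (c w : ℝ) {r : ℕ} {T T' : V → (Fin (r + 1) → ι) → ℝ} (hT : IsSmoothOn Ω T)
    (hT' : ∀ y ∈ Ω, ∀ a, T' y a = c * T y a) {x : V} (hx : x ∈ Ω) (a : Fin r → ι) :
    modifiedDivergence b (fun y => s • G y) w r T' x a =
      s⁻¹ * c * modifiedDivergence b G w r T x a := by
  have hdiv : divergence b (fun y => s • G y) T' x a = s⁻¹ * c * divergence b G T x a := by
    simp only [divergence, hG.inv_smul hs hx, hG.covDeriv_smul_metric b hs _ hx,
      covDeriv_congr b G hG.isOpen hx hT',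
      covDeriv_const_mul b G c (hT.differentiableAt hG.isOpen hx), Matrix.smul_apply, smul_eq_mul,
      Finset.mul_sum]
    exact Finset.sum_congr rfl fun i _ => Finset.sum_congr rfl fun j _ => by ring
  cases r with
  | zero => exact hdiv
  | succ q =>
    have htr : ∀ y ∈ Ω, ∀ a, traceLast (fun y => s • G y) T' y a =
        s⁻¹ * c * traceLast G T y a := fun y hy a => by
      simp only [traceLast, hG.inv_smul hs hy, hT' y hy, Matrix.smul_apply, smul_eq_mul,
        Finset.mul_sum]
      exact Finset.sum_congr rfl fun i _ => Finset.sum_congr rfl fun j _ => by ring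
    simp only [modifiedDivergence, hdiv, symmetrize, hG.covDeriv_smul_metric b hs _ hx,
      covDeriv_congr b G hG.isOpen hx htr, covDeriv_const_mul b G (s⁻¹ * c)
      ((hG.isSmoothOn_traceLast hT).differentiableAt hG.isOpen hx), ← Finset.mul_sum]
    ring

end ModifiedDivergence

/-- The sum over σ of `f (σ s)` does not depend on `s`, so `q + 1` copies of it can be computed by
summing over `s` first. It converts a symmetrization into the sum over slots that the divergence
produces. -/
theorem sum_perm_apply_zero {q : ℕ} (f : Fin (q + 1) → ℝ) :
    ((q : ℝ) + 1) * ∑ σ : Equiv.Perm (Fin (q + 1)), f (σ 0) =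
      ((q + 1).factorial : ℝ) * ∑ s, f s := by
  have h : ∀ s, ∑ σ : Equiv.Perm (Fin (q + 1)), f (σ s) =
      ∑ σ : Equiv.Perm (Fin (q + 1)), f (σ 0) := fun s =>
    Fintype.sum_equiv (Equiv.mulRight (Equiv.swap 0 s)) _ _ fun σ => by simp
  have h2 : ∑ s, ∑ σ : Equiv.Perm (Fin (q + 1)), f (σ s) =
      ((q + 1).factorial : ℝ) * ∑ s, f s := by
    rw [Finset.sum_comm]
    simp [Equiv.sum_comp, Fintype.card_perm]
  rw [← h2]
  simp [h]

/-! ### Pullbacks, the ambient metric and its Christoffel symbols. -/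

namespace PseudoRiemannianManifold

variable {n : ℕ}

/-- The index of the coordinate `x^i` among those of `(t, x, ρ)`. -/
abbrev baseIndex (i : Fin n) : AmbientIndex n := Sum.inr (Sum.inl i)

section Pullback

variable {k : ℕ}

theorem pullbackComponents_base (S : (Fin k → Fin n) → ℝ) (a : Fin k → Fin n) :
    pullbackComponents S (fun s => baseIndex (a s)) = S a := by
  have h : ∀ c : Fin k → Fin n, ((fun s => baseIndex (a s)) = fun s => baseIndex (c s)) ↔ a = c :=
    fun c => ⟨fun h => funext fun s => by simpa using congrFun h s, fun h => by rw [h]⟩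
  unfold pullbackComponents
  simp only [h]
  simp

theorem pullbackComponents_eq_zero (S : (Fin k → Fin n) → ℝ) {A : Fin k → AmbientIndex n}
    (s : Fin k) (h : ∀ i, A s ≠ baseIndex i) : pullbackComponents S A = 0 :=
  Finset.sum_eq_zero fun a _ => if_neg fun h' => h (a s) (congrFun h' s)

/-- The dichotomy behind the calculus of pullbacks: either all indices lie on the base, or every
pullback has a zero component there. -/
theorem pullback_cases (A : Fin k → AmbientIndex n) :
    (∃ a : Fin k → Fin n, A = fun s => baseIndex (a s)) ∨ ∃ s, ∀ i, A s ≠ baseIndex i := by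
  by_cases h : ∃ s, ∀ i, A s ≠ baseIndex i
  · exact Or.inr h
  · push Not at h
    choose a ha using h
    exact Or.inl ⟨a, funext ha⟩

theorem pullbackComponents_sum {α : Type} (t : Finset α) (c : α → ℝ)
    (S : α → (Fin k → Fin n) → ℝ) (A : Fin k → AmbientIndex n) :
    pullbackComponents (fun a => ∑ i ∈ t, c i * S i a) A =
      ∑ i ∈ t, c i * pullbackComponents (S i) A := by
  rcases pullback_cases A with ⟨a, rfl⟩ | ⟨s, hs⟩
  · simp only [pullbackComponents_base]
  · simp only [pullbackComponents_eq_zero _ s hs, mul_zero, Finset.sum_const_zero]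

theorem pullbackComponents_comp_perm (S : (Fin k → Fin n) → ℝ) (A : Fin k → AmbientIndex n)
    (σ : Equiv.Perm (Fin k)) :
    pullbackComponents S (A ∘ σ) = pullbackComponents (fun a => S (a ∘ σ)) A := by
  rcases pullback_cases A with ⟨a, rfl⟩ | ⟨s, hs⟩
  · rw [pullbackComponents_base]
    exact pullbackComponents_base S (a ∘ σ)
  · rw [pullbackComponents_eq_zero _ s hs, pullbackComponents_eq_zero S (σ.symm s) (by simpa)]

theorem pullbackComponents_snoc (S : (Fin (k + 1) → Fin n) → ℝ) (A : Fin k → AmbientIndex n)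
    (j : Fin n) : pullbackComponents S (Fin.snoc A (baseIndex j) : Fin (k + 1) → AmbientIndex n) =
      pullbackComponents (fun a => S (Fin.snoc a j : Fin (k + 1) → Fin n)) A := by
  rcases pullback_cases A with ⟨a, rfl⟩ | ⟨s, hs⟩
  · rw [pullbackComponents_base, ← pullbackComponents_base S]
    congr 1
    exact (Fin.comp_snoc baseIndex a j).symm
  · rw [pullbackComponents_eq_zero _ s hs, pullbackComponents_eq_zero S s.castSucc (by simpa)]

theorem pullbackComponents_cons (S : (Fin (k + 1) → Fin n) → ℝ) (A : Fin k → AmbientIndex n)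
    (j : Fin n) : pullbackComponents S (Fin.cons (baseIndex j) A : Fin (k + 1) → AmbientIndex n) =
      pullbackComponents (fun a => S (Fin.cons j a : Fin (k + 1) → Fin n)) A := by
  rcases pullback_cases A with ⟨a, rfl⟩ | ⟨s, hs⟩
  · rw [pullbackComponents_base, ← pullbackComponents_base S]
    congr 1
    exact (Fin.comp_cons baseIndex j a).symm
  · rw [pullbackComponents_eq_zero _ s hs, pullbackComponents_eq_zero S s.succ (by simpa)]

end Pullback

/-- The function `τ = t(1 + λρ)`. -/
def tau (lam : ℝ) (q : ℝ × EuclideanSpace ℝ (Fin n) × ℝ) : ℝ := q.1 * (1 + lam * q.2.2)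

/-- The components of `dτ`. -/
def tauDeriv (lam : ℝ) (q : ℝ × EuclideanSpace ℝ (Fin n) × ℝ) : AmbientIndex n → ℝ
  | .inl _ => 1 + lam * q.2.2
  | .inr (.inl _) => 0
  | .inr (.inr _) => q.1 * lam

/-- The components of the differential of the pullback of `f`. -/
noncomputable def baseDeriv (f : EuclideanSpace ℝ (Fin n) → ℝ) (x : EuclideanSpace ℝ (Fin n)) :
    AmbientIndex n → ℝ
  | .inr (.inl i) => partialDeriv (stdFrame n) i f x
  | _ => 0

/-- Used with φ the square, for the base block τ²g of the metric, and with φ the w-th power, for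
lifts. -/
theorem partialDeriv_comp_tau_mul (lam : ℝ) {q : ℝ × EuclideanSpace ℝ (Fin n) × ℝ} {φ : ℝ → ℝ}
    {φ' : ℝ} (hφ : HasDerivAt φ φ' (tau lam q)) {f : EuclideanSpace ℝ (Fin n) → ℝ}
    (hf : DifferentiableAt ℝ f q.2.1) (B : AmbientIndex n) :
    partialDeriv (ambientFrame n) B (fun p => φ (tau lam p) * f p.2.1) q =
      φ' * tauDeriv lam q B * f q.2.1 + φ (tau lam q) * baseDeriv f q.2.1 B := by
  have h1 : HasFDerivAt (fun p : ℝ × EuclideanSpace ℝ (Fin n) × ℝ => p.1)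
      (ContinuousLinearMap.fst ℝ ℝ (EuclideanSpace ℝ (Fin n) × ℝ)) q :=
    (ContinuousLinearMap.fst ℝ ℝ (EuclideanSpace ℝ (Fin n) × ℝ)).hasFDerivAt
  have h2 : HasFDerivAt (fun p : ℝ × EuclideanSpace ℝ (Fin n) × ℝ => p.2.1)
      ((ContinuousLinearMap.fst ℝ (EuclideanSpace ℝ (Fin n)) ℝ).comp
        (ContinuousLinearMap.snd ℝ ℝ (EuclideanSpace ℝ (Fin n) × ℝ))) q :=
    ((ContinuousLinearMap.fst ℝ (EuclideanSpace ℝ (Fin n)) ℝ).comp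
      (ContinuousLinearMap.snd ℝ ℝ (EuclideanSpace ℝ (Fin n) × ℝ))).hasFDerivAt
  have h3 : HasFDerivAt (fun p : ℝ × EuclideanSpace ℝ (Fin n) × ℝ => p.2.2)
      ((ContinuousLinearMap.snd ℝ (EuclideanSpace ℝ (Fin n)) ℝ).comp
        (ContinuousLinearMap.snd ℝ ℝ (EuclideanSpace ℝ (Fin n) × ℝ))) q :=
    ((ContinuousLinearMap.snd ℝ (EuclideanSpace ℝ (Fin n)) ℝ).comp
      (ContinuousLinearMap.snd ℝ ℝ (EuclideanSpace ℝ (Fin n) × ℝ))).hasFDerivAt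
  have hτ : HasFDerivAt (tau lam) _ q := h1.mul ((h3.const_mul lam).const_add 1)
  have h := (hφ.comp_hasFDerivAt q hτ).mul (hf.hasFDerivAt.comp q h2)
  unfold partialDeriv
  refine (congrArg (fun L : (ℝ × EuclideanSpace ℝ (Fin n) × ℝ →L[ℝ] ℝ) => L (ambientFrame n B))
    h.fderiv).trans ?_
  rcases B with B | B | B <;>
    simp [ambientFrame, tauDeriv, baseDeriv, partialDeriv] <;> ring

/-- The coordinate domain of the ambient space. -/
def ambientDomain (lam : ℝ) (D : Set (EuclideanSpace ℝ (Fin n))) :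
    Set (ℝ × EuclideanSpace ℝ (Fin n) × ℝ) :=
  {q | 0 < q.1 ∧ q.2.1 ∈ D ∧ 0 < 1 + lam * q.2.2}

/-- The inverse of the ambient metric. -/
noncomputable def ambientInverse (lam : ℝ) (G : EuclideanSpace ℝ (Fin n) → Matrix (Fin n) (Fin n) ℝ)
    (q : ℝ × EuclideanSpace ℝ (Fin n) × ℝ) : Matrix (AmbientIndex n) (AmbientIndex n) ℝ :=
  Matrix.of fun
    | .inl _, .inr (.inr _) => q.1⁻¹
    | .inr (.inr _), .inl _ => q.1⁻¹
    | .inr (.inr _), .inr (.inr _) => -2 * q.2.2 * (q.1⁻¹ * q.1⁻¹)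
    | .inr (.inl i), .inr (.inl j) => (tau lam q ^ 2)⁻¹ * (G q.2.1)⁻¹ i j
    | _, _ => 0

section

variable {lam : ℝ} {D : Set (EuclideanSpace ℝ (Fin n))}
  {G : EuclideanSpace ℝ (Fin n) → Matrix (Fin n) (Fin n) ℝ}
  {q : ℝ × EuclideanSpace ℝ (Fin n) × ℝ}

theorem tau_pos (hq : q ∈ ambientDomain lam D) : 0 < tau lam q := mul_pos hq.1 hq.2.2

/-- The metric is block diagonal: the (t, ρ) block has rows (2ρ, t) and (t, 0), the base block is
τ²g. -/
theorem ambientMatrix_mul_inverse (hG : IsMetricOn D G) (hq : q ∈ ambientDomain lam D) :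
    ambientMatrix lam G q * ambientInverse lam G q = 1 := by
  have ht : q.1 ≠ 0 := hq.1.ne'
  have hτ : tau lam q ≠ 0 := (tau_pos hq).ne'
  ext A B
  rw [Matrix.mul_apply, Fintype.sum_sum_type, Fintype.sum_sum_type]
  rcases A with A | A | A <;> rcases B with B | B | B <;>
    simp [ambientMatrix, ambientInverse, Matrix.one_apply, ht]
  -- The (t, ρ) entry: 2ρ · t⁻¹ + t · (-2ρ t⁻²) = 0.
  · field_simp
    ring
  · have h := hG.sum_mul_inv hq.2.1 A B
    rw [← h]
    refine Finset.sum_congr rfl fun k _ => ?_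
    change tau lam q ^ 2 * _ * _ = _
    field_simp

theorem inv_ambientMatrix (hG : IsMetricOn D G) (hq : q ∈ ambientDomain lam D) :
    (ambientMatrix lam G q)⁻¹ = ambientInverse lam G q :=
  Matrix.inv_eq_right_inv (ambientMatrix_mul_inverse hG hq)

theorem isOpen_ambientDomain (hD : IsOpen D) : IsOpen (ambientDomain lam D) := by
  have h : IsOpen {q : ℝ × EuclideanSpace ℝ (Fin n) × ℝ | 0 < 1 + lam * q.2.2} :=
    isOpen_lt continuous_const (by fun_prop)
  exact (isOpen_lt continuous_const continuous_fst).inter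
    ((hD.preimage (continuous_fst.comp continuous_snd)).inter h)

theorem isMetricOn_ambientMatrix (hG : IsMetricOn D G) :
    IsMetricOn (ambientDomain lam D) (ambientMatrix lam G) where
  isOpen := isOpen_ambientDomain hG.isOpen
  contDiffOn A B := by
    have hρ : ContDiff ℝ ∞ fun q : ℝ × EuclideanSpace ℝ (Fin n) × ℝ => q.2.2 := by fun_prop
    have ht : ContDiff ℝ ∞ fun q : ℝ × EuclideanSpace ℝ (Fin n) × ℝ => q.1 := by fun_prop
    have hx : ContDiff ℝ ∞ fun q : ℝ × EuclideanSpace ℝ (Fin n) × ℝ => q.2.1 := by fun_prop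
    rcases A with A | A | A <;> rcases B with B | B | B <;>
      simp only [ambientMatrix, Matrix.of_apply]
    any_goals exact contDiffOn_const
    any_goals exact ht.contDiffOn
    · exact (contDiff_const.mul hρ).contDiffOn
    · exact ((ht.mul (contDiff_const.add (contDiff_const.mul hρ))).pow 2).contDiffOn.mul
        ((hG.contDiffOn A B).comp hx.contDiffOn fun q hq => hq.2.1)
  symm q hq A B := by
    rcases A with A | A | A <;> rcases B with B | B | B <;>
      simp only [ambientMatrix, Matrix.of_apply]
    rw [hG.symm _ hq.2.1]
  isUnit_det q hq := Matrix.isUnit_det_of_right_inverse (ambientMatrix_mul_inverse hG hq)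

/-- The pullbacks of the Christoffel symbols of `G`. -/
noncomputable def baseChristoffel (G : EuclideanSpace ℝ (Fin n) → Matrix (Fin n) (Fin n) ℝ)
    (k : Fin n) (x : EuclideanSpace ℝ (Fin n)) : AmbientIndex n → AmbientIndex n → ℝ
  | .inr (.inl i), .inr (.inl j) => christoffel (stdFrame n) G k i j x
  | _, _ => 0

theorem sum_ambientInverse_base (k : Fin n) (F : AmbientIndex n → ℝ) :
    ∑ L, ambientInverse lam G q (baseIndex k) L * F L =
      (tau lam q ^ 2)⁻¹ * ∑ l, (G q.2.1)⁻¹ k l * F (baseIndex l) := by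
  rw [Fintype.sum_sum_type, Fintype.sum_sum_type]
  simp [ambientInverse, Finset.mul_sum, mul_assoc]

theorem partialDeriv_ambientMatrix_base (hG : IsMetricOn D G) (hq : q ∈ ambientDomain lam D)
    (B : AmbientIndex n) (i j : Fin n) :
    partialDeriv (ambientFrame n) B
        (fun p => ambientMatrix lam G p (baseIndex i) (baseIndex j)) q =
      2 * tau lam q * tauDeriv lam q B * G q.2.1 i j
        + tau lam q ^ 2 * baseDeriv (fun y => G y i j) q.2.1 B := by
  have h := partialDeriv_comp_tau_mul lam (hasDerivAt_pow 2 (tau lam q))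
    (hG.differentiableAt hq.2.1 i j) B
  refine h.trans ?_
  norm_num

theorem partialDeriv_base_ambientMatrix (i : Fin n) {A B : AmbientIndex n}
    (h : (∀ j, A ≠ baseIndex j) ∨ ∀ j, B ≠ baseIndex j) :
    partialDeriv (ambientFrame n) (baseIndex i) (fun p => ambientMatrix lam G p A B) q = 0 := by
  have h1 := (ContinuousLinearMap.fst ℝ ℝ (EuclideanSpace ℝ (Fin n) × ℝ)).hasFDerivAt (x := q)
  have h3 := ((ContinuousLinearMap.snd ℝ (EuclideanSpace ℝ (Fin n)) ℝ).comp
    (ContinuousLinearMap.snd ℝ ℝ (EuclideanSpace ℝ (Fin n) × ℝ))).hasFDerivAt (x := q)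
  have e1 : partialDeriv (ambientFrame n) (baseIndex i) (fun p => p.1) q = 0 :=
    (congrArg (fun L : (ℝ × EuclideanSpace ℝ (Fin n) × ℝ →L[ℝ] ℝ) => L _) h1.fderiv).trans
      (by simp [ambientFrame])
  have e3 : partialDeriv (ambientFrame n) (baseIndex i) (fun p => 2 * p.2.2) q = 0 :=
    (congrArg (fun L : (ℝ × EuclideanSpace ℝ (Fin n) × ℝ →L[ℝ] ℝ) => L _)
      (h3.const_mul 2).fderiv).trans (by simp [ambientFrame])
  rcases A with A | A | A <;> rcases B with B | B | B <;>
    simp only [ambientMatrix, Matrix.of_apply]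
  any_goals exact e1
  any_goals exact e3
  any_goals simp [partialDeriv]
  exact absurd rfl (h.elim (fun h => h A) fun h => (h B rfl).elim)

/-- Raising an index to the base uses only base entries of the inverse metric, so only derivatives
of τ²g and x-derivatives of the other entries occur, and the latter vanish. Symbols with upper index
t or ρ are never needed, since pullbacks have no such components. When B and C are both on the base
the dτ terms are zero. -/
theorem christoffel_ambientMatrix (hG : IsMetricOn D G) (hq : q ∈ ambientDomain lam D) (k : Fin n)
    (B C : AmbientIndex n) :
    christoffel (ambientFrame n) (ambientMatrix lam G) (baseIndex k) B C q =
      baseChristoffel G k q.2.1 B C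
        + tauDeriv lam q B / tau lam q * (if C = baseIndex k then 1 else 0)
        + tauDeriv lam q C / tau lam q * (if B = baseIndex k then 1 else 0) := by
  have hτ : tau lam q ≠ 0 := (tau_pos hq).ne'
  have hδ : ∀ i, ∑ l, (G q.2.1)⁻¹ k l * G q.2.1 i l = if i = k then 1 else 0 := fun i => by
    have h := hG.sum_inv_mul hq.2.1 k i
    simp only [eq_comm (a := i)]
    rw [← h]
    exact Finset.sum_congr rfl fun l _ => by rw [hG.symm _ hq.2.1 l i]
  have hzero : ∀ (B : AmbientIndex n) (l : Fin n) (C : AmbientIndex n), (∀ j, C ≠ baseIndex j) →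
      partialDeriv (ambientFrame n) B (fun p => ambientMatrix lam G p C (baseIndex l)) q = 0 := by
    intro B l C hC
    have : (fun p => ambientMatrix lam G p C (baseIndex l)) = fun _ => 0 := by
      funext p
      rcases C with C | C | C
      · rfl
      · exact absurd rfl (hC C)
      · rfl
    rw [this]
    simp [partialDeriv]
  unfold christoffel
  rw [inv_ambientMatrix hG hq]
  simp only [sum_ambientInverse_base]
  by_cases hB : ∃ i, B = baseIndex i <;> by_cases hC : ∃ j, C = baseIndex j
  · obtain ⟨i, rfl⟩ := hB
    obtain ⟨j, rfl⟩ := hC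
    simp only [partialDeriv_ambientMatrix_base hG hq, tauDeriv, baseDeriv, baseChristoffel,
      christoffel, zero_div, zero_mul, mul_zero, add_zero, zero_add, Finset.mul_sum]
    refine Finset.sum_congr rfl fun l _ => ?_
    field_simp
  · obtain ⟨i, rfl⟩ := hB
    push Not at hC
    have hC' : (if C = baseIndex k then (1 : ℝ) else 0) = 0 := if_neg (hC k)
    have hbC : baseChristoffel G k q.2.1 (baseIndex i) C = 0 := by
      rcases C with C | C | C
      · rfl
      · exact absurd rfl (hC C)
      · rfl
    have hdC : ∀ f : EuclideanSpace ℝ (Fin n) → ℝ, baseDeriv f q.2.1 C = 0 := fun f => by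
      rcases C with C | C | C
      · rfl
      · exact absurd rfl (hC C)
      · rfl
    simp only [hzero _ _ C hC, partialDeriv_ambientMatrix_base hG hq,
      partialDeriv_base_ambientMatrix _ (Or.inr hC), hdC, hbC, hC', mul_zero, zero_add, add_zero,
      sub_zero]
    have h := hδ i
    -- The derivative of τ² gives 2τ τ_C; together with ½ and τ⁻² this becomes τ_C/τ.
    have h2 : ∑ l, (G q.2.1)⁻¹ k l * (2 * tau lam q * tauDeriv lam q C * G q.2.1 i l) =
        2 * tau lam q * tauDeriv lam q C * if i = k then 1 else 0 := by
      rw [← h, Finset.mul_sum]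
      exact Finset.sum_congr rfl fun l _ => by ring
    rw [h2]
    simp only [Sum.inr.injEq, Sum.inl.injEq]
    field_simp
  · obtain ⟨j, rfl⟩ := hC
    push Not at hB
    have hB' : (if B = baseIndex k then (1 : ℝ) else 0) = 0 := if_neg (hB k)
    have hbB : baseChristoffel G k q.2.1 B (baseIndex j) = 0 := by
      rcases B with B | B | B
      · rfl
      · exact absurd rfl (hB B)
      · rfl
    have hdB : ∀ f : EuclideanSpace ℝ (Fin n) → ℝ, baseDeriv f q.2.1 B = 0 := fun f => by
      rcases B with B | B | B
      · rfl
      · exact absurd rfl (hB B)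
      · rfl
    simp only [hzero _ _ B hB, partialDeriv_ambientMatrix_base hG hq, hdB, hbB, hB', mul_zero, zero_add, add_zero,
      sub_zero]
    have h := hδ j
    have h2 : ∑ l, (G q.2.1)⁻¹ k l * (2 * tau lam q * tauDeriv lam q B * G q.2.1 j l) =
        2 * tau lam q * tauDeriv lam q B * if j = k then 1 else 0 := by
      rw [← h, Finset.mul_sum]
      exact Finset.sum_congr rfl fun l _ => by ring
    rw [h2]
    simp only [Sum.inr.injEq, Sum.inl.injEq]
    field_simp
  · push Not at hB hC
    have hb : baseChristoffel G k q.2.1 B C = 0 := by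
      rcases B with B | B | B
      · rfl
      · exact absurd rfl (hB B)
      · rfl
    simp only [hzero _ _ C hC, hzero _ _ B hB, partialDeriv_base_ambientMatrix _ (Or.inl hB),
      if_neg (hB k), if_neg (hC k), hb, mul_zero, add_zero, sub_zero, Finset.sum_const_zero]

end

end PseudoRiemannianManifold

/-! ### Covariant derivative, trace and divergence of the lifts τ^w π^*S. -/

namespace PseudoRiemannianManifold

variable {n : ℕ} {lam : ℝ} {D : Set (EuclideanSpace ℝ (Fin n))}
  {G : EuclideanSpace ℝ (Fin n) → Matrix (Fin n) (Fin n) ℝ}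
  {q : ℝ × EuclideanSpace ℝ (Fin n) × ℝ}

/-- The tensor field `τ^w π^* S`. -/
noncomputable def homogeneousLift (lam w : ℝ) {k : ℕ}
    (S : EuclideanSpace ℝ (Fin n) → (Fin k → Fin n) → ℝ) :
    ℝ × EuclideanSpace ℝ (Fin n) × ℝ → (Fin k → AmbientIndex n) → ℝ := fun q A =>
  tau lam q ^ w * pullbackComponents (S q.2.1) A

theorem baseDeriv_pullback {k : ℕ} (S : EuclideanSpace ℝ (Fin n) → (Fin k → Fin n) → ℝ)
    (x : EuclideanSpace ℝ (Fin n)) (A : Fin k → AmbientIndex n) (B : AmbientIndex n) :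
    baseDeriv (fun y => pullbackComponents (S y) A) x B =
      pullbackComponents (fun a => baseDeriv (fun y => S y a) x B) A := by
  rcases pullback_cases A with ⟨a, rfl⟩ | ⟨s, hs⟩
  · simp only [pullbackComponents_base]
  · simp only [pullbackComponents_eq_zero _ s hs]
    rcases B with B | B | B <;> simp [baseDeriv, partialDeriv]

theorem differentiableAt_pullback {k : ℕ} {S : EuclideanSpace ℝ (Fin n) → (Fin k → Fin n) → ℝ}
    {x : EuclideanSpace ℝ (Fin n)} (hS : ∀ a, DifferentiableAt ℝ (fun y => S y a) x)
    (A : Fin k → AmbientIndex n) :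
    DifferentiableAt ℝ (fun y => pullbackComponents (S y) A) x := by
  rcases pullback_cases A with ⟨a, rfl⟩ | ⟨s, hs⟩
  · simpa only [pullbackComponents_base] using hS a
  · simp only [pullbackComponents_eq_zero _ s hs]
    exact differentiableAt_const 0

/-- For `C` off the base the sum over base indices misses it, but then the right side is zero as
well. -/
theorem sum_ite_mul_pullback {k : ℕ} (S : (Fin k → Fin n) → ℝ) (A : Fin k → AmbientIndex n)
    (s : Fin k) (C : AmbientIndex n) :
    ∑ d, (if C = baseIndex d then 1 else 0) *
        pullbackComponents S (Function.update A s (baseIndex d)) =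
      pullbackComponents S (Function.update A s C) := by
  by_cases hC : ∃ j, C = baseIndex j
  · obtain ⟨j, rfl⟩ := hC
    simp
  · push Not at hC
    simp only [if_neg (hC _), zero_mul, Finset.sum_const_zero]
    exact (pullbackComponents_eq_zero S s (by simpa using hC)).symm

/-- Isolates the part of the ambient derivative of a lift that is free of dτ. Off the base both
sides vanish, because `baseDeriv` and `baseChristoffel` do. -/
theorem pullback_covDeriv {k : ℕ} (S : EuclideanSpace ℝ (Fin n) → (Fin k → Fin n) → ℝ)
    (x : EuclideanSpace ℝ (Fin n)) (B : AmbientIndex n) (A : Fin k → AmbientIndex n) :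
    pullbackComponents (fun a => baseDeriv (fun y => S y a) x B) A -
        ∑ s, ∑ d, baseChristoffel G d x B (A s) *
          pullbackComponents (S x) (Function.update A s (baseIndex d)) =
      pullbackComponents (covDeriv (stdFrame n) G S x)
        (Fin.cons B A : Fin (k + 1) → AmbientIndex n) := by
  by_cases hB : ∃ i, B = baseIndex i
  · obtain ⟨i, rfl⟩ := hB
    rw [pullbackComponents_cons]
    rcases pullback_cases A with ⟨a, rfl⟩ | ⟨s, hs⟩
    · have hu : ∀ s d, Function.update (fun s => baseIndex (a s)) s (baseIndex d) =
          fun t => baseIndex (Function.update a s d t) := fun s d =>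
        (Function.comp_update baseIndex a s d).symm
      simp only [pullbackComponents_base, hu]
      rfl
    · rw [pullbackComponents_eq_zero _ s hs, pullbackComponents_eq_zero _ s hs, zero_sub,
        neg_eq_zero]
      refine Finset.sum_eq_zero fun u _ => Finset.sum_eq_zero fun d _ => ?_
      -- If the off-base slot is the one being replaced, the Christoffel symbol is zero; otherwise
      -- that slot survives and kills the pullback.
      by_cases hu : u = s
      · subst hu
        have : baseChristoffel G d x (baseIndex i) (A u) = 0 := by
          revert hs
          rcases A u with C | C | C
          · exact fun _ => rfl
          · exact fun hC => absurd rfl (hC C)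
          · exact fun _ => rfl
        rw [this, zero_mul]
      · rw [pullbackComponents_eq_zero (S x) s
          (by simpa [Function.update_of_ne (Ne.symm hu)] using hs), mul_zero]
  · push Not at hB
    rw [pullbackComponents_eq_zero (covDeriv (stdFrame n) G S x) 0 (by simpa using hB)]
    rcases B with B | B | B
    · have : ∀ d C, baseChristoffel G d x (Sum.inl B) C = 0 := fun d C => rfl
      simp [baseDeriv, this, pullbackComponents]
    · exact absurd rfl (hB B)
    · have : ∀ d C, baseChristoffel G d x (Sum.inr (Sum.inr B)) C = 0 := fun d C => rfl
      simp [baseDeriv, this, pullbackComponents]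

/-- The covariant derivative of `τ^w π^* S` with respect to the ambient metric. -/
theorem covDeriv_homogeneousLift (hG : IsMetricOn D G) (hq : q ∈ ambientDomain lam D) (w : ℝ)
    {k : ℕ} {S : EuclideanSpace ℝ (Fin n) → (Fin k → Fin n) → ℝ} (hS : IsSmoothOn D S)
    (B : AmbientIndex n) (A : Fin k → AmbientIndex n) :
    covDeriv (ambientFrame n) (ambientMatrix lam G) (homogeneousLift lam w S) q
        (Fin.cons B A : Fin (k + 1) → AmbientIndex n) =
      tau lam q ^ w * (pullbackComponents (covDeriv (stdFrame n) G S q.2.1)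
          (Fin.cons B A : Fin (k + 1) → AmbientIndex n)
        + (w - k) * (tauDeriv lam q B / tau lam q * pullbackComponents (S q.2.1) A)
        - ∑ s, tauDeriv lam q (A s) / tau lam q *
            pullbackComponents (S q.2.1) (Function.update A s B)) := by
  have hτ := tau_pos hq
  have h1 := partialDeriv_comp_tau_mul lam
    (Real.hasDerivAt_rpow_const (p := w) (Or.inl hτ.ne'))
    (differentiableAt_pullback (hS.differentiableAt hG.isOpen hq.2.1) A) B
  rw [baseDeriv_pullback] at h1
  have h2 : ∀ s C, ∑ d, christoffel (ambientFrame n) (ambientMatrix lam G) d B C q *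
      homogeneousLift lam w S q (Function.update A s d) =
      tau lam q ^ w * (∑ d, baseChristoffel G d q.2.1 B C *
          pullbackComponents (S q.2.1) (Function.update A s (baseIndex d))
        + tauDeriv lam q B / tau lam q *
          pullbackComponents (S q.2.1) (Function.update A s C)
        + tauDeriv lam q C / tau lam q *
          pullbackComponents (S q.2.1) (Function.update A s B)) := by
    intro s C
    have hz1 : ∀ u : Unit, pullbackComponents (S q.2.1) (Function.update A s (Sum.inl u)) = 0 :=
      fun u => pullbackComponents_eq_zero _ s (by simp)
    have hz2 : ∀ u : Unit,
        pullbackComponents (S q.2.1) (Function.update A s (Sum.inr (Sum.inr u))) = 0 :=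
      fun u => pullbackComponents_eq_zero _ s (by simp)
    rw [Fintype.sum_sum_type, Fintype.sum_sum_type]
    simp only [homogeneousLift, hz1, hz2, mul_zero, Finset.sum_const_zero, zero_add, add_zero]
    simp only [christoffel_ambientMatrix hG hq]
    rw [← sum_ite_mul_pullback (S q.2.1) A s C, ← sum_ite_mul_pullback (S q.2.1) A s B]
    simp only [Finset.mul_sum, ← Finset.sum_add_distrib]
    exact Finset.sum_congr rfl fun d _ => by ring
  have h3 : covDeriv (ambientFrame n) (ambientMatrix lam G) (homogeneousLift lam w S) q
        (Fin.cons B A : Fin (k + 1) → AmbientIndex n) =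
      partialDeriv (ambientFrame n) B
        (fun p => tau lam p ^ w * pullbackComponents (S p.2.1) A) q -
      ∑ s, ∑ d, christoffel (ambientFrame n) (ambientMatrix lam G) d B (A s) q *
      homogeneousLift lam w S q (Function.update A s d) := rfl
  rw [h3, h1, ← pullback_covDeriv]
  -- Each of the k slots contributes -τ_B/τ and the derivative of τ^w contributes w τ_B/τ, whence
  -- the factor w - k.
  simp only [h2, ← Finset.mul_sum, Finset.sum_add_distrib, Function.update_eq_self,
    Finset.sum_const, Finset.card_univ, Fintype.card_fin, nsmul_eq_mul]
  rw [Real.rpow_sub_one hτ.ne']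
  ring

/-- A contraction with the inverse of the ambient metric. -/
theorem sum_inv_ambientMatrix (hG : IsMetricOn D G) (hq : q ∈ ambientDomain lam D)
    (F : AmbientIndex n → AmbientIndex n → ℝ)
    (hF : ∀ I J, (∀ i, I ≠ baseIndex i) → (∀ j, J ≠ baseIndex j) → F I J = 0) :
    ∑ I, ∑ J, (ambientMatrix lam G q)⁻¹ I J * F I J =
      (tau lam q ^ 2)⁻¹ * ∑ i, ∑ j, (G q.2.1)⁻¹ i j * F (baseIndex i) (baseIndex j) := by
  rw [inv_ambientMatrix hG hq, Fintype.sum_sum_type, Fintype.sum_sum_type]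
  simp only [sum_ambientInverse_base, ← Finset.mul_sum]
  -- The entries of the inverse outside the base block that are not zero have both indices off the
  -- base, where `hF` applies.
  simp [ambientInverse, hF]

theorem traceLast_homogeneousLift (hG : IsMetricOn D G) (hq : q ∈ ambientDomain lam D) (w : ℝ)
    {k : ℕ} (T : EuclideanSpace ℝ (Fin n) → (Fin (k + 2) → Fin n) → ℝ)
    (A : Fin k → AmbientIndex n) :
    traceLast (ambientMatrix lam G) (homogeneousLift lam w T) q A =
      homogeneousLift lam (w - 2) (traceLast G T) q A := by
  have hτ := tau_pos hq
  unfold traceLast homogeneousLift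
  rw [sum_inv_ambientMatrix hG hq _ fun I J _ hJ => by
    rw [pullbackComponents_eq_zero _ (Fin.last _) (by simpa using hJ), mul_zero]]
  simp only [pullbackComponents_snoc]
  have h : pullbackComponents (fun a => ∑ i, ∑ j, (G q.2.1)⁻¹ i j *
      T q.2.1 (Fin.snoc (Fin.snoc a i : Fin (k + 1) → Fin n) j : Fin (k + 2) → Fin n)) A =
      ∑ i, ∑ j, (G q.2.1)⁻¹ i j * pullbackComponents (fun a =>
        T q.2.1 (Fin.snoc (Fin.snoc a i : Fin (k + 1) → Fin n) j : Fin (k + 2) → Fin n)) A := by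
    simp only [← Fintype.sum_prod_type']
    exact pullbackComponents_sum Finset.univ (fun p : Fin n × Fin n => (G q.2.1)⁻¹ p.1 p.2) _ A
  rw [h, Real.rpow_sub hτ, Real.rpow_two]
  simp only [Finset.mul_sum]
  exact Finset.sum_congr rfl fun i _ => Finset.sum_congr rfl fun j _ => by ring

/-- The trace of `π^* T` over the slot `s` and the last slot. -/
noncomputable def traceAt (G : EuclideanSpace ℝ (Fin n) → Matrix (Fin n) (Fin n) ℝ) {r : ℕ}
    (T : EuclideanSpace ℝ (Fin n) → (Fin (r + 1) → Fin n) → ℝ) (x : EuclideanSpace ℝ (Fin n))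
    (A : Fin r → AmbientIndex n) (s : Fin r) : ℝ :=
  ∑ i, ∑ j, (G x)⁻¹ i j * pullbackComponents (T x)
    (Fin.snoc (Function.update A s (baseIndex i)) (baseIndex j) : Fin (r + 1) → AmbientIndex n)

/-- The contraction runs over base indices, on which dτ vanishes. This kills the term with factor w
- (r + 1) and the exchange with the last slot; each exchange with a free slot `s` leaves a trace
over `s` and the last slot. -/
theorem divergence_homogeneousLift (hG : IsMetricOn D G) (hq : q ∈ ambientDomain lam D) (w : ℝ)
    {r : ℕ} {T : EuclideanSpace ℝ (Fin n) → (Fin (r + 1) → Fin n) → ℝ} (hT : IsSmoothOn D T)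
    (A : Fin r → AmbientIndex n) :
    divergence (ambientFrame n) (ambientMatrix lam G) (homogeneousLift lam w T) q A =
      tau lam q ^ (w - 2) * (pullbackComponents (divergence (stdFrame n) G T q.2.1) A
        - ∑ s, tauDeriv lam q (A s) / tau lam q * traceAt G T q.2.1 A s) := by
  have hτ := tau_pos hq
  unfold divergence
  simp only [covDeriv_homogeneousLift hG hq w hT]
  rw [sum_inv_ambientMatrix hG hq]
  · have hcov : ∀ i j : Fin n, pullbackComponents (covDeriv (stdFrame n) G T q.2.1)
        (Fin.cons (baseIndex i) (Fin.snoc A (baseIndex j) : Fin (r + 1) → AmbientIndex n) :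
          Fin (r + 2) → AmbientIndex n) =
        pullbackComponents (fun a => covDeriv (stdFrame n) G T q.2.1
          (Fin.cons i (Fin.snoc a j : Fin (r + 1) → Fin n) : Fin (r + 2) → Fin n)) A :=
      fun i j => by rw [pullbackComponents_cons, pullbackComponents_snoc]
    have hb : ∀ i : Fin n, tauDeriv lam q (baseIndex i) = 0 := fun i => rfl
    have h : pullbackComponents (fun a => ∑ i, ∑ j, (G q.2.1)⁻¹ i j *
        covDeriv (stdFrame n) G T q.2.1
          (Fin.cons i (Fin.snoc a j : Fin (r + 1) → Fin n) : Fin (r + 2) → Fin n)) A =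
        ∑ i, ∑ j, (G q.2.1)⁻¹ i j * pullbackComponents (fun a =>
          covDeriv (stdFrame n) G T q.2.1
          (Fin.cons i (Fin.snoc a j : Fin (r + 1) → Fin n) : Fin (r + 2) → Fin n)) A := by
      simp only [← Fintype.sum_prod_type']
      exact pullbackComponents_sum Finset.univ (fun p : Fin n × Fin n => (G q.2.1)⁻¹ p.1 p.2) _ A
    have h2 : ∑ s, tauDeriv lam q (A s) / tau lam q * traceAt G T q.2.1 A s =
        ∑ i, ∑ j, (G q.2.1)⁻¹ i j * ∑ s, tauDeriv lam q (A s) / tau lam q *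
          pullbackComponents (T q.2.1) (Fin.snoc (Function.update A s (baseIndex i))
            (baseIndex j) : Fin (r + 1) → AmbientIndex n) := by
      simp only [traceAt, Finset.mul_sum]
      rw [Finset.sum_comm]
      refine Finset.sum_congr rfl fun i _ => ?_
      rw [Finset.sum_comm]
      exact Finset.sum_congr rfl fun j _ => Finset.sum_congr rfl fun s _ => by ring
    rw [h, h2]
    simp only [hcov, hb, zero_div, zero_mul, mul_zero, add_zero, Fin.sum_univ_castSucc,
      Fin.snoc_castSucc, Fin.snoc_last, ← Fin.snoc_update]
    rw [Real.rpow_sub hτ, Real.rpow_two, ← Finset.sum_sub_distrib]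
    simp only [← Finset.sum_sub_distrib]
    simp only [Finset.mul_sum, mul_sub, Finset.sum_sub_distrib]
    congr 1
    · exact Finset.sum_congr rfl fun i _ => Finset.sum_congr rfl fun j _ => by ring
    · exact Finset.sum_congr rfl fun i _ => Finset.sum_congr rfl fun j _ =>
        Finset.sum_congr rfl fun s _ => by ring
  · intro I J hI hJ
    rw [pullbackComponents_eq_zero (covDeriv (stdFrame n) G T q.2.1) 0 (by simpa using hI),
      pullbackComponents_eq_zero (T q.2.1) (Fin.last r) (by simpa using hJ),
      Finset.sum_eq_zero fun s _ => by
        rw [pullbackComponents_eq_zero (T q.2.1) s (by simpa using hI), mul_zero]]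
    ring

/-- Writing the traced slot as `σ 0` presents the other indices as the tail of `A ∘ σ`, the form in
which they occur in a symmetrization. By symmetry of `T`, the traced slot may be moved to the front
and then rotated to the last place but one. -/
theorem traceAt_eq {k : ℕ} {T : EuclideanSpace ℝ (Fin n) → (Fin (k + 2) → Fin n) → ℝ}
    (hT : IsSymmetricOn D T) {x : EuclideanSpace ℝ (Fin n)} (hx : x ∈ D)
    (A : Fin (k + 1) → AmbientIndex n) (σ : Equiv.Perm (Fin (k + 1))) :
    traceAt G T x A (σ 0) = pullbackComponents (traceLast G T x) (Fin.tail (A ∘ σ)) := by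
  have hperm : ∀ (π : Equiv.Perm (Fin (k + 2))) C,
      pullbackComponents (T x) (C ∘ π) = pullbackComponents (T x) C := fun π C => by
    rw [pullbackComponents_comp_perm]
    simp only [hT x hx π]
  have h : pullbackComponents (traceLast G T x) (Fin.tail (A ∘ σ)) =
      ∑ i, ∑ j, (G x)⁻¹ i j * pullbackComponents (fun a =>
        T x (Fin.snoc (Fin.snoc a i : Fin (k + 1) → Fin n) j : Fin (k + 2) → Fin n))
          (Fin.tail (A ∘ σ)) := by
    unfold traceLast
    simp only [← Fintype.sum_prod_type']
    exact pullbackComponents_sum Finset.univ (fun p : Fin n × Fin n => (G x)⁻¹ p.1 p.2) _ _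
  rw [h]
  refine Finset.sum_congr rfl fun i _ => Finset.sum_congr rfl fun j _ => ?_
  congr 1
  have hu : Function.update A (σ 0) (baseIndex i) ∘ σ =
      (Fin.cons (baseIndex i) (Fin.tail (A ∘ σ)) : Fin (k + 1) → AmbientIndex n) := by
    rw [Function.update_comp_equiv, σ.symm_apply_apply]
    conv_lhs => rw [← Fin.cons_self_tail (A ∘ σ), Fin.update_cons_zero]
  have hr : (Fin.snoc (Fin.tail (A ∘ σ)) (baseIndex i) : Fin (k + 1) → AmbientIndex n) =
      (Fin.cons (baseIndex i) (Fin.tail (A ∘ σ)) : Fin (k + 1) → AmbientIndex n) ∘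
        finRotate (k + 1) := Fin.snoc_eq_cons_rotate _ _
  rw [← pullbackComponents_snoc (fun a => T x (Fin.snoc a j : Fin (k + 2) → Fin n)),
    ← pullbackComponents_snoc, hr, snoc_comp_perm, hperm, ← hu, snoc_comp_perm, hperm]

/-- The modified divergence of `τ^w π^* T` is `τ^{w-2}` times the pullback of that of `T`. -/
theorem modifiedDivergence_homogeneousLift (hG : IsMetricOn D G) (hq : q ∈ ambientDomain lam D)
    (w : ℝ) {r : ℕ} (hw : r ≠ 0 → w - 2 * ((r + 1 : ℕ) : ℝ) + 2 ≠ 0)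
    {T : EuclideanSpace ℝ (Fin n) → (Fin (r + 1) → Fin n) → ℝ} (hT : IsSmoothOn D T)
    (hsymm : IsSymmetricOn D T) (A : Fin r → AmbientIndex n) :
    modifiedDivergence (ambientFrame n) (ambientMatrix lam G) w r (homogeneousLift lam w T) q A =
      homogeneousLift lam (w - 2) (modifiedDivergence (stdFrame n) G w r T) q A := by
  cases r with
  | zero =>
    refine (divergence_homogeneousLift hG hq w hT A).trans ?_
    -- Without free slots the divergence has no error term, so no correction is needed.
    rw [Finset.univ_eq_empty, Finset.sum_empty, sub_zero]
    rfl
  | succ k =>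
    have hc := hw k.succ_ne_zero
    push_cast at hc
    set S := traceLast G T
    have hS : IsSmoothOn D S := hG.isSmoothOn_traceLast hT
    -- This is dτ/τ ⊗ π^*(tr T), the tensor in terms of which both error terms are expressed.
    let φ : (Fin (k + 1) → AmbientIndex n) → ℝ := fun C =>
      tauDeriv lam q (C 0) / tau lam q * pullbackComponents (S q.2.1) (Fin.tail C)
    have hcov : ∀ C : Fin (k + 1) → AmbientIndex n,
        covDeriv (ambientFrame n) (ambientMatrix lam G)
          (traceLast (ambientMatrix lam G) (homogeneousLift lam w T)) q C =
        tau lam q ^ (w - 2) * (pullbackComponents (covDeriv (stdFrame n) G S q.2.1) C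
          + (w - 2 - k) * φ C - ∑ s : Fin k, φ (C ∘ Equiv.swap 0 s.succ)) := by
      intro C
      rw [covDeriv_congr (ambientFrame n) _ (isOpen_ambientDomain hG.isOpen) hq
        fun p hp A => traceLast_homogeneousLift hG hp w T A]
      have h := covDeriv_homogeneousLift hG hq (w - 2) hS (C 0) (Fin.tail C)
      rw [Fin.cons_self_tail] at h
      rw [h]
      congr 2
      refine Finset.sum_congr rfl fun s _ => ?_
      have ht : Fin.tail (C ∘ Equiv.swap 0 s.succ) = Function.update (Fin.tail C) s (C 0) := by
        funext u
        by_cases hu : u = s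
        · subst hu
          simp [Fin.tail]
        · simp [Fin.tail, Function.update_of_ne hu, Equiv.swap_apply_of_ne_of_ne
            (Fin.succ_ne_zero u) (fun h => hu (Fin.succ_injective _ h))]
      simp only [φ, ht]
      simp [Fin.tail]
    -- After symmetrization every exchange term equals φ itself.
    have hswap : ∀ s : Fin k, ∑ σ : Equiv.Perm (Fin (k + 1)), φ ((A ∘ σ) ∘ Equiv.swap 0 s.succ) =
        ∑ σ : Equiv.Perm (Fin (k + 1)), φ (A ∘ σ) := fun s =>
      Fintype.sum_equiv (Equiv.mulRight (Equiv.swap 0 s.succ)) _ _ fun σ => rfl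
    have hφ : ((k : ℝ) + 1) * ∑ σ : Equiv.Perm (Fin (k + 1)), φ (A ∘ σ) =
        ((k + 1).factorial : ℝ) * ∑ s, tauDeriv lam q (A s) / tau lam q *
          traceAt G T q.2.1 A s := by
      rw [← sum_perm_apply_zero]
      congr 1
      refine Finset.sum_congr rfl fun σ _ => ?_
      rw [traceAt_eq hsymm hq.2.1]
      rfl
    -- The error coefficient is (w - 2 - k) - k = w - 2(k + 2) + 2, where k + 2 is the rank of `T`:
    -- precisely the denominator in the modified divergence.
    have hsum : ∑ σ : Equiv.Perm (Fin (k + 1)), covDeriv (ambientFrame n) (ambientMatrix lam G)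
          (traceLast (ambientMatrix lam G) (homogeneousLift lam w T)) q (A ∘ σ) =
        tau lam q ^ (w - 2) *
          (∑ σ : Equiv.Perm (Fin (k + 1)),
            pullbackComponents (covDeriv (stdFrame n) G S q.2.1) (A ∘ σ)
          + (w - 2 - 2 * k) * ∑ σ : Equiv.Perm (Fin (k + 1)), φ (A ∘ σ)) := by
      simp only [hcov]
      have hcomm := Finset.sum_comm (s := (Finset.univ : Finset (Equiv.Perm (Fin (k + 1)))))
        (t := (Finset.univ : Finset (Fin k)))
        (f := fun σ s => φ ((A ∘ σ) ∘ Equiv.swap 0 s.succ))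
      rw [← Finset.mul_sum, Finset.sum_sub_distrib, Finset.sum_add_distrib, ← Finset.mul_sum, hcomm]
      simp only [hswap, Finset.sum_const, Finset.card_univ, Fintype.card_fin, nsmul_eq_mul]
      ring
    have hpull : pullbackComponents (modifiedDivergence (stdFrame n) G w (k + 1) T q.2.1) A =
        pullbackComponents (divergence (stdFrame n) G T q.2.1) A
          + (((k + 2 : ℕ) : ℝ) - 1) / (w - 2 * ((k + 2 : ℕ) : ℝ) + 2) *
            ((1 / ((k + 1).factorial : ℝ)) * ∑ σ : Equiv.Perm (Fin (k + 1)),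
              pullbackComponents (covDeriv (stdFrame n) G S q.2.1) (A ∘ σ)) := by
      simp only [pullbackComponents_comp_perm]
      rcases pullback_cases A with ⟨a, rfl⟩ | ⟨s, hs⟩
      · simp only [pullbackComponents_base]
        rfl
      · simp only [pullbackComponents_eq_zero _ s hs, Finset.sum_const_zero, mul_zero, add_zero]
    have hL : modifiedDivergence (ambientFrame n) (ambientMatrix lam G) w (k + 1)
        (homogeneousLift lam w T) q A =
        divergence (ambientFrame n) (ambientMatrix lam G) (homogeneousLift lam w T) q A
          + (((k + 2 : ℕ) : ℝ) - 1) / (w - 2 * ((k + 2 : ℕ) : ℝ) + 2) *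
            ((1 / ((k + 1).factorial : ℝ)) * ∑ σ : Equiv.Perm (Fin (k + 1)),
              covDeriv (ambientFrame n) (ambientMatrix lam G)
                (traceLast (ambientMatrix lam G) (homogeneousLift lam w T)) q (A ∘ σ)) := rfl
    rw [hL, divergence_homogeneousLift hG hq w hT, hsum]
    unfold homogeneousLift
    rw [hpull]
    have hf : ((k + 1).factorial : ℝ) ≠ 0 := by positivity
    -- The error of the divergence is k + 1 times the symmetrization of φ, matching the numerator of
    -- the coefficient.
    have hΨ : ∑ s, tauDeriv lam q (A s) / tau lam q * traceAt G T q.2.1 A s =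
        ((k : ℝ) + 1) * (∑ σ : Equiv.Perm (Fin (k + 1)), φ (A ∘ σ)) / ((k + 1).factorial : ℝ) := by
      rw [hφ]
      field_simp
    rw [hΨ]
    push_cast
    have hc' : w - 2 * ((k : ℝ) + 2) + 2 ≠ 0 := by
      convert hc using 1
      ring
    field_simp
    ring

end PseudoRiemannianManifold

/-! ### Assembly of the proposition. -/

theorem mainTheorem6 (n : ℕ) (hn : 3 ≤ n) (r : ℕ) (w : ℝ)
    (hw : r ≠ 0 → w - 2 * ((r + 1 : ℕ) : ℝ) + 2 ≠ 0)
    (T : RiemannianInvariant (r + 1)) (hsymm : T.IsSymmetric n)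
    (hstraight : T.IsStraightenable n w) :
    ∃ U : RiemannianInvariant r,
      (∀ (m : ℕ) (X : PseudoRiemannianManifold m) (e : X.Chart), ∀ x ∈ e.1.target,
        ∀ a : Fin r → Fin m,
          U.eval (stdFrame m) (X.gram e) x a
            = modifiedDivergence (stdFrame m) (X.gram e) w r
                (T.eval (stdFrame m) (X.gram e)) x a) ∧
      U.IsSymmetric n ∧ U.IsStraightenable n (w - 2) := by
  obtain ⟨U, hU⟩ := (IsInvariantRule.of_eval T).modifiedDivergence w
  have hUX : ∀ (m : ℕ) (X : PseudoRiemannianManifold m) (e : X.Chart), ∀ x ∈ e.1.target,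
      ∀ a : Fin r → Fin m, U.eval (stdFrame m) (X.gram e) x a =
        modifiedDivergence (stdFrame m) (X.gram e) w r
          (T.eval (stdFrame m) (X.gram e)) x a := fun m X e x hx a =>
    hU _ _ (stdFrame m) (X.gram e) _ (X.isMetricOn_gram e) x hx a
  have hTsymm : ∀ (X : PseudoRiemannianManifold n) (e : X.Chart),
      IsSymmetricOn e.1.target (T.eval (stdFrame n) (X.gram e)) := fun X e x hx σ a =>
    hsymm X e x hx σ a
  refine ⟨U, hUX, fun X e x hx σ a => ?_, fun X c hc e x hx a => ?_, ?_⟩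
  · rw [hUX n X e x hx, hUX n X e x hx]
    exact modifiedDivergence_comp_perm _ _ e.1.open_target w (hTsymm X e) hx σ a
  · have hG := X.isMetricOn_gram e
    have hs : c ^ 2 ≠ 0 := pow_ne_zero 2 hc.ne'
    -- With s = c², the components of `T` scale by c^w and the extra inverse metric by c⁻², giving
    -- c^(w-2).
    have hw' := hstraight.1 X c hc e
    rw [X.metricComponents_smul] at hw' ⊢
    refine (hU _ _ _ _ _ (hG.smul hs) x hx a).trans ((hG.modifiedDivergence_smul _ hs (c ^ w) w
      (hG.isSmoothOn_eval _ T) hw' hx a).trans ?_)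
    rw [hUX n X e x hx, Real.rpow_sub hc, Real.rpow_two]
    ring
  · intro X lam hX ε hε hpos e t ht x hx rho hrho A
    have hG := X.isMetricOn_gram e
    let Ω : Set (ℝ × EuclideanSpace ℝ (Fin n) × ℝ) :=
      Set.Ioi 0 ×ˢ e.1.target ×ˢ Set.Ioo (-ε) ε
    have hΩ : IsOpen Ω := isOpen_Ioi.prod (e.1.open_target.prod isOpen_Ioo)
    have hq : (t, x, rho) ∈ Ω := ⟨ht, hx, hrho⟩
    have hΩD : Ω ⊆ PseudoRiemannianManifold.ambientDomain lam e.1.target :=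
      fun q hq => ⟨hq.1, hq.2.1, hpos _ hq.2.2⟩
    have hamb := PseudoRiemannianManifold.isMetricOn_ambientMatrix (lam := lam) hG
    have hGΩ : ∀ q ∈ Ω, X.ambientGram lam e q =
        PseudoRiemannianManifold.ambientMatrix lam (X.gram e) q := fun q hq =>
      X.ambientGram_eq lam e hq.2.1
    have hmetric : IsMetricOn Ω (X.ambientGram lam e) :=
      { isOpen := hΩ
        contDiffOn := fun i j => ((hamb.contDiffOn i j).mono hΩD).congr fun q hq => by
          rw [hGΩ q hq]
        symm := fun q hq i j => by rw [hGΩ q hq, hamb.symm q (hΩD hq)]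
        isUnit_det := fun q hq => by
          rw [hGΩ q hq]
          exact hamb.isUnit_det q (hΩD hq) }
    -- Straightenability is used at all points of the open set `Ω`, since the modified divergence
    -- differentiates `T`.
    have hTΩ : ∀ q ∈ Ω, ∀ A, T.eval (PseudoRiemannianManifold.ambientFrame n)
        (X.ambientGram lam e) q A = PseudoRiemannianManifold.homogeneousLift lam w
          (T.eval (stdFrame n) (X.gram e)) q A := fun q hq A =>
      hstraight.2 X lam hX ε hε hpos e q.1 hq.1 q.2.1 hq.2.1 q.2.2 hq.2.2 A
    refine (hU _ _ _ _ Ω hmetric _ hq A).trans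
      ((modifiedDivergence_congr _ hΩ hGΩ w hTΩ hq A).trans
      ((PseudoRiemannianManifold.modifiedDivergence_homogeneousLift hG (hΩD hq) w hw
        (hG.isSmoothOn_eval _ T) (hTsymm X e) A).trans ?_))
    have hUfun : U.eval (stdFrame n) (X.gram e) x =
        modifiedDivergence (stdFrame n) (X.gram e) w r (T.eval (stdFrame n) (X.gram e)) x :=
      funext fun a => hUX n X e x hx a
    rw [hUfun]
    rfl
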